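/- A monoid $M$ is *atomic* if it is generated by its atoms (an atom is an element $x\neq 1$ such that $x=yz$ implies $y=1$ or $z=1$) and if, for every $x\in M$, the lengths of the decompositions of $x$ as a product of atoms are bounded. $M$ is *Gaussian* if it is atomic, left and right cancellative, and any two elements admit a right lcm, a left lcm, a right gcd and a left gcd. A *Garside monoid* is a Gaussian monoid $M$ that contains an element $\Delta$ whose left divisors coincide with its right divisors, are finite in number, and generate $M$. A *Garside group* is a group that is the group of fractions of some Garside monoid. A finite monoid presentation consists of an integer $n\ge 0$ and a finite list of pairs of words in the letters $0,\dots,n-1$; a finite group presentation consists of an integer $n\ge 0$ and a finite list of pairs of words in the letters $0,\dots,n-1$ and their formal inverses. **Theorem.** (1) Being a Garside group is a $\Sigma^0_1$ (that is, recursively enumerable) property of finite group presentations: the set of finite group presentations $P$ such that the group presented by $P$ is a Garside group is recursively enumerable. (2) Being a Garside monoid is a $\Sigma^0_1$ property of finite monoid presentations: the set of finite monoid presentations $P$ such that the monoid presented by $P$ is a Garside monoid is recursively enumerable. (3) Consequently there is an algorithm that lists all Garside groups: there is a computable sequence of finite group presentations whose terms are exactly the finite presentations of Garside groups, and every Garside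 group is isomorphic to the group presented by some term of the sequence. (4) Likewise there is an algorithm that lists all Garside monoids: there is a computable sequence of finite monoid presentations whose terms are exactly the finite presentations of Garside monoids, and every Garside monoid is isomorphic to the monoid presented by some term of the sequence. -/

import Mathlib

universe u

namespace Garside

section Monoids

/-! In a monoid, `x ∣ y` means that `x` is a left divisor of `y` (`y = x * z` for some `z`), and
`x ∣ᵣ y` that `x` is a right divisor of `y` (`y = z * x` for some `z`). -/

variable {M : Type*} [Monoid M]

/-- `z` is a right lcm of `x` and `y`. -/
def IsRightLcm (x y z : M) : Prop :=
  x ∣ z ∧ y ∣ z ∧ ∀ w, x ∣ w → y ∣ w → z ∣ w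

/-- `z` is a left lcm of `x` and `y`. -/
def IsLeftLcm (x y z : M) : Prop :=
  x ∣ᵣ z ∧ y ∣ᵣ z ∧ ∀ w, x ∣ᵣ w → y ∣ᵣ w → z ∣ᵣ w

/-- `z` is a left gcd of `x` and `y`. -/
def IsLeftGcd (x y z : M) : Prop :=
  z ∣ x ∧ z ∣ y ∧ ∀ w, w ∣ x → w ∣ y → w ∣ z

/-- `z` is a right gcd of `x` and `y`. -/
def IsRightGcd (x y z : M) : Prop :=
  z ∣ᵣ x ∧ z ∣ᵣ y ∧ ∀ w, w ∣ᵣ x → w ∣ᵣ y → w ∣ᵣ z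

/-- `x` is an atom: `x ≠ 1`, and `x = yz` forces `y = 1` or `z = 1`. -/
def IsMonoidAtom (x : M) : Prop := x ≠ 1 ∧ ∀ y z, x = y * z → y = 1 ∨ z = 1

variable (M) in
/-- `M` is atomic: it is generated by its atoms, and for every `x` the lengths of the
decompositions of `x` as a product of atoms are bounded. -/
structure IsAtomicMonoid : Prop where
  closure_atoms : Submonoid.closure {a : M | IsMonoidAtom a} = ⊤
  norm_finite : ∀ x : M, ∃ n : ℕ, ∀ l : List M,
    (∀ a ∈ l, IsMonoidAtom a) → l.prod = x → l.length ≤ n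

variable (M) in
/-- Gaussian monoids: atomic, cancellative, with lcm's and gcd's on both sides. -/
structure IsGaussianMonoid : Prop where
  atomic : IsAtomicMonoid M
  cancel : IsCancelMul M
  right_lcm : ∀ x y : M, ∃ z, IsRightLcm x y z
  left_lcm : ∀ x y : M, ∃ z, IsLeftLcm x y z
  right_gcd : ∀ x y : M, ∃ z, IsRightGcd x y z
  left_gcd : ∀ x y : M, ∃ z, IsLeftGcd x y z

/-- `Δ` is a Garside element: its left divisors coincide with its right divisors, they are
finite in number, and they generate the monoid. -/
structure IsGarsideElement (Δ : M) : Prop where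
  left_iff_right : ∀ x, x ∣ Δ ↔ x ∣ᵣ Δ
  finite : {x : M | x ∣ Δ}.Finite
  closure_divisors : Submonoid.closure {x : M | x ∣ Δ} = ⊤

variable (M) in
/-- Garside monoids: Gaussian monoids that contain a Garside element. -/
structure IsGarsideMonoid : Prop where
  gaussian : IsGaussianMonoid M
  exists_garside : ∃ Δ : M, IsGarsideElement Δ

/-- The group `G` is, through `ι`, the group of fractions of the monoid `M`: `ι` embeds `M` in
`G`, and every element of `G` is both a left fraction and a right fraction of elements of `M`. -/
structure IsGroupOfFractions {G : Type*} [Group G] (ι : M →* G) : Prop where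
  injective : Function.Injective ι
  left_fraction : ∀ g : G, ∃ x y : M, g = (ι x)⁻¹ * ι y
  right_fraction : ∀ g : G, ∃ x y : M, g = ι x * (ι y)⁻¹

end Monoids

/-- Garside groups: the groups of fractions of Garside monoids. -/
def IsGarsideGroup (G : Type u) [Group G] : Prop :=
  ∃ (M : Type u) (_ : Monoid M) (ι : M →* G), IsGarsideMonoid M ∧ IsGroupOfFractions ι

section Presentations

/-- A list of letters all of which are `< n`. -/
def WordBelow (n : ℕ) (w : List ℕ) : Prop := ∀ a ∈ w, a < n

/-- A list of signed letters all of which are `< n`. -/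
def SignedWordBelow (n : ℕ) (w : List (ℕ × Bool)) : Prop := ∀ a ∈ w, a.1 < n

/-- `(n, R)` is a finite monoid presentation: `R` is a list of pairs of words in the letters
`0, …, n - 1`. -/
def MonoidPresentationOk (p : ℕ × List (List ℕ × List ℕ)) : Prop :=
  ∀ r ∈ p.2, WordBelow p.1 r.1 ∧ WordBelow p.1 r.2

/-- `(n, R)` is a finite group presentation: `R` is a list of pairs of words in the letters
`0, …, n - 1` and their formal inverses; `(i, true)` is the letter `i`, and `(i, false)` its
inverse. -/
def GroupPresentationOk (p : ℕ × List (List (ℕ × Bool) × List (ℕ × Bool))) : Prop :=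
  ∀ r ∈ p.2, SignedWordBelow p.1 r.1 ∧ SignedWordBelow p.1 r.2

instance (n : ℕ) (w : List ℕ) : Decidable (WordBelow n w) :=
  inferInstanceAs (Decidable (∀ a ∈ w, a < n))

instance (n : ℕ) (w : List (ℕ × Bool)) : Decidable (SignedWordBelow n w) :=
  inferInstanceAs (Decidable (∀ a ∈ w, a.1 < n))

instance : DecidablePred MonoidPresentationOk := fun p =>
  inferInstanceAs (Decidable (∀ r ∈ p.2, WordBelow p.1 r.1 ∧ WordBelow p.1 r.2))

instance : DecidablePred GroupPresentationOk := fun p =>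
  inferInstanceAs (Decidable (∀ r ∈ p.2, SignedWordBelow p.1 r.1 ∧ SignedWordBelow p.1 r.2))

theorem primrecPred_wordBelow :
    PrimrecPred fun q : List ℕ × ℕ => WordBelow q.2 q.1 :=
  PrimrecRel.forall_mem_list (R := fun a n : ℕ => a < n) Primrec.nat_lt

theorem primrecPred_signedWordBelow :
    PrimrecPred fun q : List (ℕ × Bool) × ℕ => SignedWordBelow q.2 q.1 :=
  PrimrecRel.forall_mem_list (R := fun (a : ℕ × Bool) (n : ℕ) => a.1 < n)
    (Primrec.nat_lt.comp (Primrec.fst.comp Primrec.fst) Primrec.snd)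

theorem primrecPred_monoidPresentationOk : PrimrecPred MonoidPresentationOk := by
  have h : PrimrecRel fun (r : List ℕ × List ℕ) (n : ℕ) => WordBelow n r.1 ∧ WordBelow n r.2 :=
    (primrecPred_wordBelow.comp
      (Primrec.pair (Primrec.fst.comp Primrec.fst) Primrec.snd)).and
    (primrecPred_wordBelow.comp
      (Primrec.pair (Primrec.snd.comp Primrec.fst) Primrec.snd))
  exact (PrimrecRel.forall_mem_list h).comp Primrec.snd Primrec.fst

theorem primrecPred_groupPresentationOk : PrimrecPred GroupPresentationOk := by
  have h : PrimrecRel fun (r : List (ℕ × Bool) × List (ℕ × Bool)) (n : ℕ) =>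
      SignedWordBelow n r.1 ∧ SignedWordBelow n r.2 :=
    (primrecPred_signedWordBelow.comp
      (Primrec.pair (Primrec.fst.comp Primrec.fst) Primrec.snd)).and
    (primrecPred_signedWordBelow.comp
      (Primrec.pair (Primrec.snd.comp Primrec.fst) Primrec.snd))
  exact (PrimrecRel.forall_mem_list h).comp Primrec.snd Primrec.fst

/-- Finite monoid presentations. -/
def MonoidPresentation : Type :=
  {p : ℕ × List (List ℕ × List ℕ) // MonoidPresentationOk p}

/-- Finite group presentations. -/
def GroupPresentation : Type :=
  {p : ℕ × List (List (ℕ × Bool) × List (ℕ × Bool)) // GroupPresentationOk p}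

instance : Primcodable MonoidPresentation :=
  Primcodable.subtype primrecPred_monoidPresentationOk

instance : Primcodable GroupPresentation :=
  Primcodable.subtype primrecPred_groupPresentationOk

/-- The relations of a finite monoid presentation on `n` generators, on the free monoid on
`Fin n`. -/
def MonoidPresentation.rels (P : MonoidPresentation) (u v : FreeMonoid (Fin P.1.1)) : Prop :=
  ((FreeMonoid.toList u).map Fin.val, (FreeMonoid.toList v).map Fin.val) ∈ P.1.2

/-- The monoid defined by a finite monoid presentation. -/
abbrev MonoidPresentation.toMonoid (P : MonoidPresentation) : Type := PresentedMonoid P.rels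

/-- The relators `u v⁻¹`, for `u = v` a relation of a finite group presentation on `n`
generators, in the free group on `Fin n`. -/
def GroupPresentation.rels (P : GroupPresentation) : Set (FreeGroup (Fin P.1.1)) :=
  {g | ∃ u v : List (Fin P.1.1 × Bool),
    (u.map (Prod.map Fin.val id), v.map (Prod.map Fin.val id)) ∈ P.1.2 ∧
      g = FreeGroup.mk u * (FreeGroup.mk v)⁻¹}

/-- The group defined by a finite group presentation. -/
abbrev GroupPresentation.toGroup (P : GroupPresentation) : Type := PresentedGroup P.rels

end Presentations

end Garside

/-!
Let `D` be the finite set of divisors of a Garside element `Δ`. The right complement `s⁻¹ (s ∨ t)`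
maps `D × D` to `D`, and the relations `s (s⁻¹ (s ∨ t)) = t (t⁻¹ (s ∨ t))`, together with `e = 1`
for the letter `e` of `1`, present the monoid on the generators `D`. Conversely, let `rc` and `lc`
be two finite tables that satisfy the identities of a right and of a left complement, the cube law
being the essential one, and that are linked to each other by the existence of products. Word
reversing shows that `rc` presents a cancellative monoid with right lcm's, the symmetric argument
applies to `lc`, and both monoids coincide, so the monoid is a Garside monoid. Such a pair of tables
is thus a certificate that can be checked by a primitive recursive procedure.

A finitely presented monoid is therefore a Garside monoid exactly when it is isomorphic to a
certified one, and isomorphism of finite presentations is `Σ⁰₁`: search for words that represent the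
images of the generators in both directions, and for derivations that show that relations are
preserved and that the two maps are inverse to each other. For groups, observe that the group of
fractions of a Garside monoid is presented, as a group, by any presentation of the monoid.
-/

namespace Garside

section Complement

variable {S : Type*}

/-- The laws satisfied by the right complement `rc s t = s⁻¹ (s ∨ t)` on the divisors of an
element of a monoid with right lcm's, the letter `e` standing for `1`. The left complement
`lc s t = (s ∨ t) s⁻¹`, written with `s` first as well, satisfies the same laws. -/
structure ComplementLaws (rc : S → S → S) (e : S) : Prop where
  self : ∀ s, rc s s = e
  one_left : ∀ s, rc e s = s
  one_right : ∀ s, rc s e = e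
  cube : ∀ s t r, rc (rc s t) (rc s r) = rc (rc t s) (rc t r)

/-- The complement `s⁻¹ (s ∨ v)` of a word `v` by a letter `s`. -/
def letterCompl (rc : S → S → S) : S → List S → List S
  | _, [] => []
  | s, t :: v => rc s t :: letterCompl rc (rc t s) v

/-- The complement `v⁻¹ (s ∨ v)` of a letter `s` by a word `v`. -/
def complLetter (rc : S → S → S) : List S → S → S
  | [], s => s
  | t :: v, s => complLetter rc v (rc t s)

/-- The complement `u⁻¹ (u ∨ v)` of a word `v` by a word `u`: the words `u` and `v` are the left
and top sides of a grid, each cell of which is a square `s * rc s t = t * rc t s`, and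
`wordCompl rc u v` is read on the bottom side. -/
def wordCompl (rc : S → S → S) : List S → List S → List S
  | [], v => v
  | s :: u, v => wordCompl rc u (letterCompl rc s v)

/-- Words that represent `1` letter by letter. -/
def IsTrivialWord (e : S) (w : List S) : Prop := ∀ a ∈ w, a = e

/-- The equivalence of words defined by the complement: each word divides the other one. -/
def WordEquiv (rc : S → S → S) (e : S) (u v : List S) : Prop :=
  IsTrivialWord e (wordCompl rc u v) ∧ IsTrivialWord e (wordCompl rc v u)

variable {rc : S → S → S} {e : S}

theorem isTrivialWord_nil : IsTrivialWord e ([] : List S) := List.forall_mem_nil _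

theorem isTrivialWord_cons {a : S} {v : List S} :
    IsTrivialWord e (a :: v) ↔ a = e ∧ IsTrivialWord e v := List.forall_mem_cons

theorem isTrivialWord_append {u v : List S} :
    IsTrivialWord e (u ++ v) ↔ IsTrivialWord e u ∧ IsTrivialWord e v := List.forall_mem_append

theorem WordEquiv.symm {u v : List S} (h : WordEquiv rc e u v) : WordEquiv rc e v u :=
  And.symm h

variable (rc) in
theorem length_letterCompl (s : S) (v : List S) : (letterCompl rc s v).length = v.length := by
  induction v generalizing s with
  | nil => rfl
  | cons t v ih => simp [letterCompl, ih]

variable (rc) in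
theorem length_wordCompl (u v : List S) : (wordCompl rc u v).length = v.length := by
  induction u generalizing v with
  | nil => rfl
  | cons s u ih => simp [wordCompl, ih, length_letterCompl]

variable (rc) in
theorem wordCompl_nil (u : List S) : wordCompl rc u [] = [] :=
  List.eq_nil_of_length_eq_zero (length_wordCompl rc u [])

variable (rc) in
theorem letterCompl_append (s : S) (v w : List S) :
    letterCompl rc s (v ++ w) = letterCompl rc s v ++ letterCompl rc (complLetter rc v s) w := by
  induction v generalizing s with
  | nil => rfl
  | cons t v ih => simp [letterCompl, complLetter, ih]

variable (rc) in
theorem wordCompl_append_left (u w v : List S) :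
    wordCompl rc (u ++ w) v = wordCompl rc w (wordCompl rc u v) := by
  induction u generalizing v with
  | nil => rfl
  | cons s u ih => simp [wordCompl, ih]

variable (rc) in
theorem wordCompl_cons_right (v : List S) (s : S) (u : List S) :
    wordCompl rc v (s :: u) = complLetter rc v s :: wordCompl rc (letterCompl rc s v) u := by
  induction v generalizing s u with
  | nil => rfl
  | cons t v ih => simp [wordCompl, letterCompl, complLetter, ih]

variable (rc) in
theorem wordCompl_append_right (u v w : List S) :
    wordCompl rc u (v ++ w) = wordCompl rc u v ++ wordCompl rc (wordCompl rc v u) w := by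
  induction u generalizing v w with
  | nil => simp [wordCompl_nil, wordCompl]
  | cons s u ih => simp [wordCompl, letterCompl_append, ih, wordCompl_cons_right]

namespace ComplementLaws

theorem letterCompl_one (h : ComplementLaws rc e) (v : List S) : letterCompl rc e v = v := by
  induction v with
  | nil => rfl
  | cons t v ih => simp [letterCompl, h.one_left, h.one_right, ih]

theorem complLetter_one (h : ComplementLaws rc e) (v : List S) : complLetter rc v e = e := by
  induction v with
  | nil => rfl
  | cons t v ih => simp [complLetter, h.one_right, ih]

theorem letterCompl_cube (h : ComplementLaws rc e) (s t : S) (w : List S) :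
    letterCompl rc (rc s t) (letterCompl rc s w) =
      letterCompl rc (rc t s) (letterCompl rc t w) := by
  induction w generalizing s t with
  | nil => rfl
  | cons r w ih =>
    simp only [letterCompl, h.cube s t r, h.cube s r t, h.cube t r s]
    rw [ih]

theorem wordCompl_letterCompl_cube (h : ComplementLaws rc e) (s : S) (v w : List S) :
    wordCompl rc (letterCompl rc s v) (letterCompl rc s w) =
      letterCompl rc (complLetter rc v s) (wordCompl rc v w) := by
  induction v generalizing s w with
  | nil => rfl
  | cons t v ih =>
    simp only [letterCompl, wordCompl, complLetter]
    rw [h.letterCompl_cube, ih]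

theorem wordCompl_cube (h : ComplementLaws rc e) (u v w : List S) :
    wordCompl rc (wordCompl rc u v) (wordCompl rc u w) =
      wordCompl rc (wordCompl rc v u) (wordCompl rc v w) := by
  induction u generalizing v w with
  | nil => simp [wordCompl_nil, wordCompl]
  | cons s u ih =>
    simp only [wordCompl_cons_right, wordCompl]
    rw [ih, h.wordCompl_letterCompl_cube]

theorem wordCompl_of_isTrivialWord (h : ComplementLaws rc e) {u : List S}
    (hu : IsTrivialWord e u) (v : List S) : wordCompl rc u v = v := by
  induction u with
  | nil => rfl
  | cons s u ih =>
    obtain ⟨rfl, hu⟩ := isTrivialWord_cons.1 hu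
    simp [wordCompl, h.letterCompl_one, ih hu]

theorem isTrivialWord_wordCompl (h : ComplementLaws rc e) (u : List S) {v : List S}
    (hv : IsTrivialWord e v) : IsTrivialWord e (wordCompl rc u v) := by
  induction v generalizing u with
  | nil => rwa [wordCompl_nil]
  | cons s v ih =>
    obtain ⟨rfl, hv⟩ := isTrivialWord_cons.1 hv
    rw [wordCompl_cons_right, isTrivialWord_cons]
    exact ⟨h.complLetter_one u, ih _ hv⟩

theorem isTrivialWord_wordCompl_self (h : ComplementLaws rc e) (u : List S) :
    IsTrivialWord e (wordCompl rc u u) := by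
  induction u with
  | nil => exact isTrivialWord_nil
  | cons s u ih =>
    simp only [wordCompl, letterCompl, h.self, h.letterCompl_one, wordCompl_cons_right,
      isTrivialWord_cons]
    exact ⟨h.complLetter_one u, ih⟩

theorem isTrivialWord_wordCompl_trans (h : ComplementLaws rc e) {u v w : List S}
    (huv : IsTrivialWord e (wordCompl rc v u)) (hvw : IsTrivialWord e (wordCompl rc w v)) :
    IsTrivialWord e (wordCompl rc w u) := by
  have hcube := h.wordCompl_cube w v u
  rw [h.wordCompl_of_isTrivialWord hvw] at hcube
  rw [hcube]
  exact h.isTrivialWord_wordCompl _ huv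

theorem isTrivialWord_wordCompl_append_left_iff (h : ComplementLaws rc e) (w u v : List S) :
    IsTrivialWord e (wordCompl rc (w ++ u) (w ++ v)) ↔ IsTrivialWord e (wordCompl rc u v) := by
  have hw := h.isTrivialWord_wordCompl_self w
  rw [wordCompl_append_left, wordCompl_append_right, h.wordCompl_of_isTrivialWord hw,
    wordCompl_append_right, h.wordCompl_of_isTrivialWord hw, isTrivialWord_append]
  exact and_iff_right (h.isTrivialWord_wordCompl _ hw)

theorem isTrivialWord_wordCompl_append_right (h : ComplementLaws rc e) (w : List S)
    {u v : List S} (huv : WordEquiv rc e u v) :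
    IsTrivialWord e (wordCompl rc (u ++ w) (v ++ w)) := by
  rw [wordCompl_append_left, wordCompl_append_right, h.wordCompl_of_isTrivialWord huv.2,
    wordCompl_append_right, h.wordCompl_of_isTrivialWord huv.1, isTrivialWord_append]
  exact ⟨h.isTrivialWord_wordCompl _ huv.1, h.isTrivialWord_wordCompl_self w⟩

theorem wordEquiv_refl (h : ComplementLaws rc e) (u : List S) : WordEquiv rc e u u :=
  ⟨h.isTrivialWord_wordCompl_self u, h.isTrivialWord_wordCompl_self u⟩

theorem wordEquiv_trans (h : ComplementLaws rc e) {u v w : List S} (huv : WordEquiv rc e u v)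
    (hvw : WordEquiv rc e v w) : WordEquiv rc e u w :=
  ⟨h.isTrivialWord_wordCompl_trans hvw.1 huv.1, h.isTrivialWord_wordCompl_trans huv.2 hvw.2⟩

theorem wordEquiv_append (h : ComplementLaws rc e) {u u' v v' : List S}
    (hu : WordEquiv rc e u u') (hv : WordEquiv rc e v v') :
    WordEquiv rc e (u ++ v) (u' ++ v') := by
  refine h.wordEquiv_trans (v := u ++ v') ⟨?_, ?_⟩ ⟨?_, ?_⟩
  · exact (h.isTrivialWord_wordCompl_append_left_iff _ _ _).2 hv.1
  · exact (h.isTrivialWord_wordCompl_append_left_iff _ _ _).2 hv.2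
  · exact h.isTrivialWord_wordCompl_append_right _ hu
  · exact h.isTrivialWord_wordCompl_append_right _ hu.symm

/-- The congruence on the free monoid whose quotient is the monoid presented by a complement. -/
def con (h : ComplementLaws rc e) : Con (FreeMonoid S) where
  r u v := WordEquiv rc e u.toList v.toList
  iseqv := ⟨fun u => h.wordEquiv_refl u.toList, WordEquiv.symm, h.wordEquiv_trans⟩
  mul' := h.wordEquiv_append

end ComplementLaws

/-- `f` maps the relations `s * rc s t = t * rc t s` and `e = 1` of a complement to equalities. -/
structure RespectsComplement {M : Type*} [Monoid M] (rc : S → S → S) (e : S) (f : S → M) :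
    Prop where
  map_one : f e = 1
  map_rel : ∀ s t, f s * f (rc s t) = f t * f (rc t s)

namespace RespectsComplement

variable {M : Type*} [Monoid M] {f : S → M}

theorem prod_eq_one (h : RespectsComplement rc e f) {u : List S} (hu : IsTrivialWord e u) :
    (u.map f).prod = 1 := by
  refine List.prod_eq_one fun x hx => ?_
  obtain ⟨a, ha, rfl⟩ := List.mem_map.1 hx
  rw [hu a ha, h.map_one]

theorem mul_letterCompl (h : RespectsComplement rc e f) (s : S) (v : List S) :
    f s * ((letterCompl rc s v).map f).prod = (v.map f).prod * f (complLetter rc v s) := by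
  induction v generalizing s with
  | nil => simp [letterCompl, complLetter]
  | cons t v ih =>
    simp only [letterCompl, complLetter, List.map_cons, List.prod_cons]
    rw [← mul_assoc, h.map_rel, mul_assoc, ih, mul_assoc]

theorem mul_wordCompl (h : RespectsComplement rc e f) (u v : List S) :
    (u.map f).prod * ((wordCompl rc u v).map f).prod =
      (v.map f).prod * ((wordCompl rc v u).map f).prod := by
  induction u generalizing v with
  | nil => simp [wordCompl, wordCompl_nil]
  | cons s u ih =>
    simp only [wordCompl_cons_right, wordCompl, List.map_cons, List.prod_cons]
    rw [mul_assoc, ih, ← mul_assoc, h.mul_letterCompl, mul_assoc]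

theorem prod_eq_of_wordEquiv (h : RespectsComplement rc e f) {u v : List S}
    (huv : WordEquiv rc e u v) : (u.map f).prod = (v.map f).prod := by
  simpa only [h.prod_eq_one huv.1, h.prod_eq_one huv.2, mul_one] using h.mul_wordCompl u v

end RespectsComplement

/-- `M` is, through `ι`, the monoid presented by the generators `S` and the relations
`s * rc s t = t * rc t s` and `e = 1` of a complement. -/
structure IsComplementPresentation {M : Type*} [Monoid M] (rc : S → S → S) (e : S) (ι : S → M) :
    Prop extends RespectsComplement rc e ι where
  laws : ComplementLaws rc e
  surj : ∀ x : M, ∃ u : List S, (u.map ι).prod = x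
  wordEquiv : ∀ u v : List S, (u.map ι).prod = (v.map ι).prod → WordEquiv rc e u v

theorem ComplementLaws.isComplementPresentation (h : ComplementLaws rc e) :
    IsComplementPresentation rc e fun s => (FreeMonoid.of s : h.con.Quotient) := by
  have hprod (u : List S) : (u.map fun s => (FreeMonoid.of s : h.con.Quotient)).prod =
      h.con.mk' (FreeMonoid.ofList u) := by
    rw [← FreeMonoid.toList_ofList u, ← FreeMonoid.lift_apply]
    exact DFunLike.congr_fun (FreeMonoid.lift_restrict h.con.mk') (FreeMonoid.ofList u)
  have hmk {u v : List S} :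
      h.con.mk' (FreeMonoid.ofList u) = h.con.mk' (FreeMonoid.ofList v) ↔ WordEquiv rc e u v :=
    Con.eq _
  refine ⟨⟨hmk (u := [e]) (v := []).2 ?_,
      fun s t => hmk (u := [s, rc s t]) (v := [t, rc t s]).2 ?_⟩,
    h, fun x => ?_, fun u v huv => ?_⟩
  · simp [WordEquiv, wordCompl, letterCompl, IsTrivialWord]
  · simp [WordEquiv, wordCompl, letterCompl, IsTrivialWord, h.self]
  · obtain ⟨u, rfl⟩ := Con.mk'_surjective x
    exact ⟨u.toList, hprod u.toList⟩
  · rwa [hprod, hprod, hmk] at huv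

namespace IsComplementPresentation

variable {M : Type*} [Monoid M] {ι : S → M}

theorem dvd_iff (h : IsComplementPresentation rc e ι) {u v : List S} :
    (u.map ι).prod ∣ (v.map ι).prod ↔ IsTrivialWord e (wordCompl rc v u) := by
  constructor
  · rintro ⟨y, hy⟩
    obtain ⟨w, rfl⟩ := h.surj y
    rw [← List.prod_append, ← List.map_append] at hy
    refine h.laws.isTrivialWord_wordCompl_trans (v := u ++ w) ?_ (h.wordEquiv _ _ hy).1
    rw [wordCompl_append_left]
    exact h.laws.isTrivialWord_wordCompl _ (h.laws.isTrivialWord_wordCompl_self u)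
  · intro hu
    have hrel := h.mul_wordCompl u v
    rw [h.prod_eq_one hu, mul_one] at hrel
    exact ⟨_, hrel.symm⟩

theorem isLeftCancelMul (h : IsComplementPresentation rc e ι) : IsLeftCancelMul M where
  mul_left_cancel x y z hxy := by
    obtain ⟨w, rfl⟩ := h.surj x
    obtain ⟨u, rfl⟩ := h.surj y
    obtain ⟨v, rfl⟩ := h.surj z
    simp only [← List.prod_append, ← List.map_append] at hxy
    have hwuv := h.wordEquiv _ _ hxy
    exact h.prod_eq_of_wordEquiv ⟨(h.laws.isTrivialWord_wordCompl_append_left_iff w u v).1 hwuv.1,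
      (h.laws.isTrivialWord_wordCompl_append_left_iff w v u).1 hwuv.2⟩

theorem exists_isRightLcm (h : IsComplementPresentation rc e ι) (x y : M) :
    ∃ z, IsRightLcm x y z := by
  obtain ⟨u, rfl⟩ := h.surj x
  obtain ⟨v, rfl⟩ := h.surj y
  refine ⟨(u.map ι).prod * ((wordCompl rc u v).map ι).prod, dvd_mul_right _ _, ?_, ?_⟩
  · rw [h.mul_wordCompl]
    exact dvd_mul_right _ _
  · intro z hu hv
    obtain ⟨w, rfl⟩ := h.surj z
    rw [h.dvd_iff] at hu hv
    rw [← List.prod_append, ← List.map_append, h.dvd_iff, wordCompl_append_right,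
      isTrivialWord_append, h.laws.wordCompl_cube u w v]
    exact ⟨hu, h.laws.isTrivialWord_wordCompl _ hv⟩

theorem subsingleton_units (h : IsComplementPresentation rc e ι) : Subsingleton Mˣ := by
  refine subsingleton_of_forall_eq 1 fun x => Units.ext ?_
  obtain ⟨u, hu⟩ := h.surj x.1
  obtain ⟨v, hv⟩ := h.surj x.2
  have huv : (([] : List S).map ι).prod = ((u ++ v).map ι).prod := by simp [hu, hv]
  rw [← hu, h.prod_eq_one (isTrivialWord_append.1 (h.wordEquiv _ _ huv).1).1, Units.val_one]

theorem exists_length_eq_of_mul_eq (h : IsComplementPresentation rc e ι) {x y : M} {v : List S}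
    (hxy : x * y = (v.map ι).prod) : ∃ w : List S, w.length = v.length ∧ (w.map ι).prod = y := by
  have := h.isLeftCancelMul
  obtain ⟨u, rfl⟩ := h.surj x
  refine ⟨wordCompl rc u v, length_wordCompl rc u v, mul_left_cancel (a := (u.map ι).prod) ?_⟩
  rw [h.mul_wordCompl, h.prod_eq_one (h.dvd_iff.1 ⟨y, hxy.symm⟩), mul_one, hxy]

theorem exists_lift (h : IsComplementPresentation rc e ι) {N : Type*} [Monoid N] {f : S → N}
    (hf : RespectsComplement rc e f) : ∃ F : M →* N, ∀ s, F (ι s) = f s := by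
  choose w hw using h.surj
  have hmap {u v : List S} (huv : (u.map ι).prod = (v.map ι).prod) :
      (u.map f).prod = (v.map f).prod :=
    hf.prod_eq_of_wordEquiv (h.wordEquiv u v huv)
  refine ⟨⟨⟨fun x => ((w x).map f).prod, ?_⟩, fun x y => ?_⟩, fun s => ?_⟩
  · simpa using hmap (u := w 1) (v := []) (by simp [hw])
  · simpa using hmap (u := w (x * y)) (v := w x ++ w y) (by simp [hw])
  · simpa using hmap (u := w (ι s)) (v := [s]) (by simp [hw])

theorem hom_ext (h : IsComplementPresentation rc e ι) {N : Type*} [Monoid N] {F G : M →* N}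
    (hFG : ∀ s, F (ι s) = G (ι s)) : F = G := by
  ext x
  obtain ⟨u, rfl⟩ := h.surj x
  simp only [map_list_prod, List.map_map, Function.comp_def, hFG]

theorem nonempty_mulEquiv (h : IsComplementPresentation rc e ι) {N : Type*} [Monoid N] {κ : S → N}
    (hκ : IsComplementPresentation rc e κ) : Nonempty (M ≃* N) := by
  obtain ⟨F, hF⟩ := h.exists_lift hκ.toRespectsComplement
  obtain ⟨G, hG⟩ := hκ.exists_lift h.toRespectsComplement
  exact ⟨F.toMulEquiv G (h.hom_ext (by simp [hF, hG])) (hκ.hom_ext (by simp [hF, hG]))⟩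

end IsComplementPresentation

end Complement

section FiniteDivisors

variable {M : Type*} [Monoid M]

theorem ncard_dvd_lt_ncard_dvd_mul_left [IsLeftCancelMul M] [Subsingleton Mˣ]
    (hfin : ∀ x : M, {y : M | y ∣ x}.Finite) {y : M} (hy : y ≠ 1) (z : M) :
    {w : M | w ∣ z}.ncard < {w : M | w ∣ y * z}.ncard := by
  rw [← Set.ncard_image_of_injective {w : M | w ∣ z} (mul_right_injective y)]
  refine Set.ncard_lt_ncard ⟨?_, fun h => ?_⟩ (hfin _)
  · rintro _ ⟨w, hw, rfl⟩
    exact mul_dvd_mul_left y hw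
  · obtain ⟨w, -, hw⟩ := h (one_dvd _)
    exact hy (isUnit_iff_eq_one.1 (.of_mul_eq_one _ hw))

theorem ncard_dvd_lt_ncard_dvd_mul_right [IsLeftCancelMul M] [Subsingleton Mˣ]
    (hfin : ∀ x : M, {y : M | y ∣ x}.Finite) (y : M) {z : M} (hz : z ≠ 1) :
    {w : M | w ∣ y}.ncard < {w : M | w ∣ y * z}.ncard := by
  refine Set.ncard_lt_ncard ⟨fun w hw => hw.trans (dvd_mul_right _ _), fun h => ?_⟩ (hfin _)
  obtain ⟨w, hw⟩ := h (dvd_refl (y * z))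
  rw [mul_assoc, left_eq_mul] at hw
  exact hz (isUnit_iff_eq_one.1 (.of_mul_eq_one _ hw))

theorem closure_isMonoidAtom_eq_top [IsLeftCancelMul M] [Subsingleton Mˣ]
    (hfin : ∀ x : M, {y : M | y ∣ x}.Finite) :
    Submonoid.closure {a : M | IsMonoidAtom a} = ⊤ := by
  rw [Submonoid.eq_top_iff']
  intro x
  induction hn : {w : M | w ∣ x}.ncard using Nat.strong_induction_on generalizing x with
  | _ n ih =>
    subst hn
    by_cases hx : x = 1
    · exact hx ▸ one_mem _
    by_cases hatom : IsMonoidAtom x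
    · exact Submonoid.subset_closure hatom
    simp only [IsMonoidAtom, not_and, not_forall, not_or] at hatom
    obtain ⟨y, z, rfl, hy, hz⟩ := hatom hx
    exact mul_mem (ih _ (ncard_dvd_lt_ncard_dvd_mul_right hfin y hz) _ rfl)
      (ih _ (ncard_dvd_lt_ncard_dvd_mul_left hfin hy z) _ rfl)

theorem length_le_ncard_dvd_prod [IsLeftCancelMul M] [Subsingleton Mˣ]
    (hfin : ∀ x : M, {y : M | y ∣ x}.Finite) {l : List M} (hl : ∀ a ∈ l, a ≠ 1) :
    l.length ≤ {w : M | w ∣ l.prod}.ncard := by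
  induction l with
  | nil => exact Nat.zero_le _
  | cons a l ih =>
    rw [List.forall_mem_cons] at hl
    rw [List.prod_cons]
    exact (ih hl.2).trans_lt (ncard_dvd_lt_ncard_dvd_mul_left hfin hl.1 l.prod)

theorem isAtomicMonoid_of_finite_dvd [IsLeftCancelMul M] [Subsingleton Mˣ]
    (hfin : ∀ x : M, {y : M | y ∣ x}.Finite) : IsAtomicMonoid M where
  closure_atoms := closure_isMonoidAtom_eq_top hfin
  norm_finite x := ⟨{w : M | w ∣ x}.ncard, fun _ hl hx =>
    hx ▸ length_le_ncard_dvd_prod hfin fun a ha => (hl a ha).1⟩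

theorem exists_isLeast_common_multiple (hlcm : ∀ x y : M, ∃ z, IsRightLcm x y z) {s : Set M}
    (hs : s.Finite) : ∃ z, (∀ w ∈ s, w ∣ z) ∧ ∀ v, (∀ w ∈ s, w ∣ v) → z ∣ v := by
  induction s, hs using Set.Finite.induction_on with
  | empty => exact ⟨1, by simp⟩
  | @insert a s _ _ ih =>
    obtain ⟨z, hsz, hz⟩ := ih
    obtain ⟨m, ham, hzm, hm⟩ := hlcm a z
    simp only [Set.forall_mem_insert]
    exact ⟨m, ⟨ham, fun w hw => (hsz w hw).trans hzm⟩, fun v hv => hm v hv.1 (hz v hv.2)⟩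

theorem exists_isLeftGcd_of_finite_dvd (hfin : ∀ x : M, {y : M | y ∣ x}.Finite)
    (hlcm : ∀ x y : M, ∃ z, IsRightLcm x y z) (x y : M) : ∃ z, IsLeftGcd x y z := by
  obtain ⟨z, hz, hmin⟩ := exists_isLeast_common_multiple hlcm
    ((hfin x).subset fun w (hw : w ∣ x ∧ w ∣ y) => hw.1)
  exact ⟨z, hmin x fun w hw => hw.1, hmin y fun w hw => hw.2, fun w hx hy => hz w ⟨hx, hy⟩⟩

end FiniteDivisors

section Opposite

open MulOpposite

variable {M : Type*} [Monoid M]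

theorem dvd_iff_op_rightDvd_op {x y : M} : x ∣ y ↔ op x ∣ᵣ op y :=
  ⟨fun ⟨z, hz⟩ => ⟨op z, congrArg op hz⟩, fun ⟨z, hz⟩ => ⟨z.unop, op_injective hz⟩⟩

theorem isLeftLcm_iff_op {x y z : M} : IsLeftLcm x y z ↔ IsRightLcm (op x) (op y) (op z) := by
  simp only [IsLeftLcm, IsRightLcm, rightDvd_iff_op_dvd_op, op_surjective.forall]

theorem isRightGcd_iff_op {x y z : M} : IsRightGcd x y z ↔ IsLeftGcd (op x) (op y) (op z) := by
  simp only [IsRightGcd, IsLeftGcd, rightDvd_iff_op_dvd_op, op_surjective.forall]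

end Opposite

section Germ

open MulOpposite

variable {S : Type*} {rc lc : S → S → S} {e Δ : S}

/-- The relation `s * t = r` read on a right complement: `s` divides `r`, with quotient `t`. For a
left complement, the relation `s * t = r` is `IsQuotient lc e t s r`. -/
def IsQuotient (rc : S → S → S) (e s t r : S) : Prop := rc r s = e ∧ rc s r = t

/-- One half of the laws of the two complements on the divisors of a Garside element `Δ`: the
equalities `s * rc s t = t * rc t s` hold in the monoid presented by `lc`. -/
structure IsHalfGerm (rc lc : S → S → S) (e Δ : S) : Prop where
  laws : ComplementLaws rc e
  top : ∀ s, rc Δ s = e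
  exists_mul : ∀ s t, ∃ r, IsQuotient lc e (rc s t) s r ∧ IsQuotient lc e (rc t s) t r

/-- The right complement `rc` and the left complement `lc` on a set `S` with distinguished
elements `e` and `Δ` are those of the set of divisors of a Garside element: by the results below,
`rc` and `lc` present the same monoid, in which `Δ` is such an element. -/
structure IsGerm (rc lc : S → S → S) (e Δ : S) : Prop where
  right : IsHalfGerm rc lc e Δ
  left : IsHalfGerm lc rc e Δ

theorem RespectsComplement.mul_eq {M : Type*} [Monoid M] {f : S → M}
    (h : RespectsComplement rc e f) {s t r : S} (hstr : IsQuotient rc e s t r) :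
    f s * f t = f r := by
  simpa only [hstr.1, hstr.2, h.map_one, mul_one] using h.map_rel s r

theorem IsHalfGerm.respectsComplement_op (h : IsHalfGerm rc lc e Δ) {M : Type*} [Monoid M]
    {f : S → M} (hf : RespectsComplement lc e f) : RespectsComplement rc e fun s => op (f s) where
  map_one := by rw [hf.map_one, op_one]
  map_rel s t := by
    obtain ⟨r, hs, ht⟩ := h.exists_mul s t
    rw [← op_mul, ← op_mul, hf.mul_eq hs, hf.mul_eq ht]

namespace IsComplementPresentation

variable {M : Type*} [Monoid M] {ι : S → M}

theorem op (h : IsComplementPresentation rc e ι) (hg : IsGerm rc lc e Δ) :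
    IsComplementPresentation lc e fun s => op (ι s) := by
  have hκ := hg.left.laws.isComplementPresentation
  obtain ⟨F, hF⟩ := h.exists_lift (hg.right.respectsComplement_op hκ.toRespectsComplement)
  have hreverse (u : List S) : (u.map fun s => MulOpposite.op (ι s)).prod =
      MulOpposite.op (u.reverse.map ι).prod := by
    simp [op_list_prod, Function.comp_def]
  refine ⟨hg.left.respectsComplement_op h.toRespectsComplement, hg.left.laws, fun x => ?_,
    fun u v huv => hκ.wordEquiv u v ?_⟩
  · obtain ⟨u, hu⟩ := h.surj x.unop
    exact ⟨u.reverse, by rw [hreverse, List.reverse_reverse, hu, op_unop]⟩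
  · rw [hreverse, hreverse, op_inj] at huv
    apply MulOpposite.op_injective
    simpa [op_list_prod, map_list_prod, hF, Function.comp_def] using congrArg F huv

theorem finite_rightDvd [Finite S] (h : IsComplementPresentation rc e ι) (y : M) :
    {x : M | x ∣ᵣ y}.Finite := by
  obtain ⟨v, rfl⟩ := h.surj y
  refine ((List.finite_length_eq S v.length).image fun w => (w.map ι).prod).subset ?_
  rintro x ⟨z, hz⟩
  exact h.exists_length_eq_of_mul_eq hz.symm

theorem exists_eq_of_rightDvd (h : IsComplementPresentation rc e ι) {x : M} {s : S}
    (hx : x ∣ᵣ ι s) : ∃ t, ι t = x := by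
  obtain ⟨z, hz⟩ := hx
  obtain ⟨w, hw, rfl⟩ := h.exists_length_eq_of_mul_eq (v := [s]) (x := z) (y := x) (by simp [hz])
  obtain ⟨t, rfl⟩ := List.length_eq_one_iff.1 hw
  exact ⟨t, by simp⟩

theorem dvd_top (h : IsComplementPresentation rc e ι) (htop : ∀ s, rc Δ s = e) (s : S) :
    ι s ∣ ι Δ := by
  have hdvd := h.dvd_iff (u := [s]) (v := [Δ])
  simpa [wordCompl, letterCompl, IsTrivialWord, htop] using hdvd

theorem isGaussianMonoid [Finite S] (hr : IsComplementPresentation rc e ι)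
    (hl : IsComplementPresentation lc e fun s => MulOpposite.op (ι s)) : IsGaussianMonoid M := by
  have := hr.isLeftCancelMul
  have := hl.isLeftCancelMul
  have := hr.subsingleton_units
  have hfin (x : M) : {y : M | y ∣ x}.Finite :=
    ((hl.finite_rightDvd (MulOpposite.op x)).preimage op_injective.injOn).subset
      fun _ => dvd_iff_op_rightDvd_op.1
  have hfin_op (x : Mᵐᵒᵖ) : {y : Mᵐᵒᵖ | y ∣ x}.Finite :=
    ((hr.finite_rightDvd x.unop).preimage unop_injective.injOn).subset
      fun _ => rightDvd_iff_op_dvd_op.2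
  refine ⟨isAtomicMonoid_of_finite_dvd hfin,
    { mul_right_cancel := fun x y z hyz => ?_ }, hr.exists_isRightLcm, fun x y => ?_, fun x y => ?_,
    exists_isLeftGcd_of_finite_dvd hfin hr.exists_isRightLcm⟩
  · exact op_injective (mul_left_cancel (a := MulOpposite.op x) (congrArg MulOpposite.op hyz))
  · obtain ⟨z, hz⟩ := hl.exists_isRightLcm (MulOpposite.op x) (MulOpposite.op y)
    exact ⟨z.unop, isLeftLcm_iff_op.2 hz⟩
  · obtain ⟨z, hz⟩ := exists_isLeftGcd_of_finite_dvd hfin_op hl.exists_isRightLcm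
      (MulOpposite.op x) (MulOpposite.op y)
    exact ⟨z.unop, isRightGcd_iff_op.2 hz⟩

theorem isGarsideElement [Finite S] (hr : IsComplementPresentation rc e ι)
    (hl : IsComplementPresentation lc e fun s => MulOpposite.op (ι s))
    (hrtop : ∀ s, rc Δ s = e) (hltop : ∀ s, lc Δ s = e) : IsGarsideElement (ι Δ) := by
  have hdvd (x : M) : x ∣ ι Δ ↔ x ∈ Set.range ι := by
    refine ⟨fun hx => ?_, ?_⟩
    · obtain ⟨s, hs⟩ := hl.exists_eq_of_rightDvd (dvd_iff_op_rightDvd_op.1 hx)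
      exact ⟨s, op_injective hs⟩
    · rintro ⟨s, rfl⟩
      exact hr.dvd_top hrtop s
  have hrightDvd (x : M) : x ∣ᵣ ι Δ ↔ x ∈ Set.range ι := by
    refine ⟨hr.exists_eq_of_rightDvd, ?_⟩
    rintro ⟨s, rfl⟩
    exact rightDvd_iff_op_dvd_op.2 (hl.dvd_top hltop s)
  refine ⟨fun x => (hdvd x).trans (hrightDvd x).symm, ?_, ?_⟩
  · exact (Set.finite_range ι).subset fun x => (hdvd x).1
  · rw [Submonoid.eq_top_iff']
    intro x
    obtain ⟨u, rfl⟩ := hr.surj x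
    refine Submonoid.list_prod_mem _ (List.forall_mem_map.2 fun s _ => ?_)
    exact Submonoid.subset_closure ((hdvd _).2 ⟨s, rfl⟩)

theorem isGarsideMonoid [Finite S] (h : IsComplementPresentation rc e ι)
    (hg : IsGerm rc lc e Δ) : IsGarsideMonoid M :=
  ⟨h.isGaussianMonoid (h.op hg), ι Δ, h.isGarsideElement (h.op hg) hg.right.top hg.left.top⟩

end IsComplementPresentation

end Germ

section LcmComplement

open MulOpposite

variable {M : Type*} [Monoid M]

theorem IsRightLcm.symm {x y z : M} (h : IsRightLcm x y z) : IsRightLcm y x z :=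
  ⟨h.2.1, h.1, fun w hy hx => h.2.2 w hx hy⟩

theorem isRightLcm_one_left (x : M) : IsRightLcm 1 x x :=
  ⟨one_dvd x, dvd_rfl, fun _ _ => id⟩

theorem isRightLcm_of_dvd {x y : M} (h : y ∣ x) : IsRightLcm x y x :=
  ⟨dvd_rfl, h, fun _ hx _ => hx⟩

variable {S : Type*} {ι : S → M} {rc lc : S → S → S} {e Δ : S}

/-- `rc` is the complement `s⁻¹ (s ∨ t)` on a family of elements of a monoid, read on its indices;
`e` is the index of `1`. -/
structure IsLcmComplement (ι : S → M) (rc : S → S → S) (e : S) : Prop where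
  injective : Function.Injective ι
  map_one : ι e = 1
  isRightLcm : ∀ s t, IsRightLcm (ι s) (ι t) (ι s * ι (rc s t))

theorem exists_isLcmComplement (hlcm : ∀ x y : M, ∃ z, IsRightLcm x y z)
    (hinj : Function.Injective ι) (hΔ : ∀ x, x ∣ ι Δ ↔ x ∈ Set.range ι)
    (hbal : ∀ x, x ∣ ι Δ ↔ x ∣ᵣ ι Δ) (he : ι e = 1) : ∃ rc, IsLcmComplement ι rc e := by
  have hrc (s t : S) : ∃ r, IsRightLcm (ι s) (ι t) (ι s * ι r) := by
    obtain ⟨z, hz⟩ := hlcm (ι s) (ι t)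
    obtain ⟨c, rfl⟩ := hz.1
    obtain ⟨k, hk⟩ := hz.2.2 (ι Δ) ((hΔ _).2 ⟨s, rfl⟩) ((hΔ _).2 ⟨t, rfl⟩)
    have hck : c * k ∣ ι Δ := (hbal _).2 ⟨ι s, by rw [hk, mul_assoc]⟩
    obtain ⟨r, rfl⟩ := (hΔ c).1 ((dvd_mul_right c k).trans hck)
    exact ⟨r, hz⟩
  choose rc hrc using hrc
  exact ⟨rc, hinj, he, hrc⟩

variable [IsLeftCancelMul M]

theorem IsRightLcm.mul_left {x x' y y' z : M} (h : IsRightLcm x y (x * y'))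
    (h' : IsRightLcm x' y' (x' * z)) : IsRightLcm (x * x') y (x * x' * z) := by
  refine ⟨dvd_mul_right _ _, h.2.1.trans ?_, ?_⟩
  · exact mul_assoc x x' z ▸ mul_dvd_mul_left x h'.2.1
  · rintro _ ⟨w, rfl⟩ hy
    rw [mul_assoc] at hy ⊢
    obtain ⟨v, hv⟩ := h.2.2 _ (dvd_mul_right _ _) hy
    rw [mul_assoc, mul_right_inj] at hv
    rw [mul_assoc]
    exact mul_dvd_mul_left x (h'.2.2 _ (dvd_mul_right _ _) ⟨v, hv⟩)

theorem IsLcmComplement.isRightLcm_complLetter (h : IsLcmComplement ι rc e) (v : List S) (s : S) :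
    IsRightLcm (v.map ι).prod (ι s) ((v.map ι).prod * ι (complLetter rc v s)) := by
  induction v generalizing s with
  | nil => simpa [complLetter] using isRightLcm_one_left (ι s)
  | cons t v ih =>
    rw [List.map_cons, List.prod_cons]
    exact (h.isRightLcm t s).mul_left (ih (rc t s))

variable [Subsingleton Mˣ]

theorem dvd_antisymm_of_subsingleton_units {x y : M} (hxy : x ∣ y) (hyx : y ∣ x) : x = y := by
  obtain ⟨c, rfl⟩ := hxy
  obtain ⟨d, hd⟩ := hyx
  rw [mul_assoc, left_eq_mul] at hd
  rw [isUnit_iff_eq_one.1 (.of_mul_eq_one d hd), mul_one]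

theorem IsRightLcm.unique {x y z z' : M} (h : IsRightLcm x y z) (h' : IsRightLcm x y z') :
    z = z' :=
  dvd_antisymm_of_subsingleton_units (h.2.2 z' h'.1 h'.2.1) (h'.2.2 z h.1 h.2.1)

namespace IsLcmComplement

theorem respectsComplement (h : IsLcmComplement ι rc e) : RespectsComplement rc e ι where
  map_one := h.map_one
  map_rel s t := (h.isRightLcm s t).unique (h.isRightLcm t s).symm

theorem eq_of_isRightLcm (h : IsLcmComplement ι rc e) {s t r : S}
    (hr : IsRightLcm (ι s) (ι t) (ι s * ι r)) : rc s t = r :=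
  h.injective (mul_left_cancel ((h.isRightLcm s t).unique hr))

theorem eq_one_of_dvd (h : IsLcmComplement ι rc e) {s t : S} (hst : ι t ∣ ι s) : rc s t = e :=
  h.eq_of_isRightLcm (by simpa only [h.map_one, mul_one] using isRightLcm_of_dvd hst)

theorem isQuotient (h : IsLcmComplement ι rc e) {s t r : S} (hr : ι s * ι t = ι r) :
    IsQuotient rc e s t r := by
  have hsr : ι s ∣ ι r := ⟨ι t, hr.symm⟩
  exact ⟨h.eq_one_of_dvd hsr, h.eq_of_isRightLcm (hr ▸ (isRightLcm_of_dvd hsr).symm)⟩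

theorem complementLaws (h : IsLcmComplement ι rc e) : ComplementLaws rc e where
  self s := h.eq_one_of_dvd dvd_rfl
  one_left s := (h.isQuotient (by rw [h.map_one, one_mul])).2
  one_right s := h.eq_one_of_dvd (h.map_one ▸ one_dvd _)
  cube s t r := by
    have hlcm (s t : S) : IsRightLcm (ι s * ι (rc s t)) (ι r)
        (ι s * ι (rc s t) * ι (rc (rc s t) (rc s r))) :=
      (h.isRightLcm s r).mul_left (h.isRightLcm (rc s t) (rc s r))
    have hst := hlcm s t
    rw [h.respectsComplement.map_rel] at hst
    exact h.injective (mul_left_cancel (hst.unique (hlcm t s)))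

theorem isRightLcm_wordCompl (h : IsLcmComplement ι rc e) (u v : List S) :
    IsRightLcm (u.map ι).prod (v.map ι).prod
      ((u.map ι).prod * ((wordCompl rc u v).map ι).prod) := by
  induction u generalizing v with
  | nil => simpa [wordCompl] using isRightLcm_one_left (v.map ι).prod
  | cons s u ih =>
    have hs : IsRightLcm (ι s) (v.map ι).prod (ι s * ((letterCompl rc s v).map ι).prod) := by
      rw [h.respectsComplement.mul_letterCompl]
      exact (h.isRightLcm_complLetter v s).symm
    rw [List.map_cons, List.prod_cons]
    exact hs.mul_left (ih (letterCompl rc s v))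

theorem isTrivialWord_of_prod_eq_one (h : IsLcmComplement ι rc e) {u : List S}
    (hu : (u.map ι).prod = 1) : IsTrivialWord e u := by
  induction u with
  | nil => exact isTrivialWord_nil
  | cons s u ih =>
    rw [List.map_cons, List.prod_cons] at hu
    have hs : ι s = 1 := isUnit_iff_eq_one.1 (.of_mul_eq_one _ hu)
    rw [hs, one_mul] at hu
    exact isTrivialWord_cons.2 ⟨h.injective (hs.trans h.map_one.symm), ih hu⟩

theorem isTrivialWord_wordCompl_of_dvd (h : IsLcmComplement ι rc e) {u v : List S}
    (huv : (v.map ι).prod ∣ (u.map ι).prod) : IsTrivialWord e (wordCompl rc u v) := by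
  refine h.isTrivialWord_of_prod_eq_one ?_
  rw [← mul_eq_left (a := (u.map ι).prod)]
  exact (h.isRightLcm_wordCompl u v).unique (isRightLcm_of_dvd huv)

theorem isComplementPresentation (h : IsLcmComplement ι rc e)
    (hsurj : Submonoid.closure (Set.range ι) = ⊤) : IsComplementPresentation rc e ι where
  toRespectsComplement := h.respectsComplement
  laws := h.complementLaws
  surj x := by
    rw [← FreeMonoid.mrange_lift, MonoidHom.mrange_eq_top] at hsurj
    obtain ⟨u, hu⟩ := hsurj x
    exact ⟨u.toList, (FreeMonoid.lift_apply ι u).symm.trans hu⟩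
  wordEquiv u v huv := ⟨h.isTrivialWord_wordCompl_of_dvd huv.symm.dvd,
    h.isTrivialWord_wordCompl_of_dvd huv.dvd⟩

theorem isHalfGerm (h : IsLcmComplement ι rc e) (hΔ : ∀ x, x ∣ ι Δ ↔ x ∈ Set.range ι)
    (hlc : ∀ s t r, ι s * ι t = ι r → IsQuotient lc e t s r) : IsHalfGerm rc lc e Δ where
  laws := h.complementLaws
  top s := h.eq_one_of_dvd ((hΔ _).2 ⟨s, rfl⟩)
  exists_mul s t := by
    have hlcm := h.isRightLcm s t
    obtain ⟨r, hr⟩ := (hΔ _).1 (hlcm.2.2 (ι Δ) ((hΔ _).2 ⟨s, rfl⟩) ((hΔ _).2 ⟨t, rfl⟩))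
    exact ⟨r, hlc _ _ _ hr.symm, hlc _ _ _ (by rw [hr, h.respectsComplement.map_rel])⟩

end IsLcmComplement

end LcmComplement

section GarsideGerm

open MulOpposite

variable {M : Type*} [Monoid M]

theorem IsAtomicMonoid.exists_list (h : IsAtomicMonoid M) (x : M) :
    ∃ l : List M, (∀ a ∈ l, IsMonoidAtom a) ∧ l.prod = x :=
  Submonoid.exists_list_of_mem_closure (h.closure_atoms ▸ Submonoid.mem_top x)

theorem IsAtomicMonoid.eq_nil_of_prod_eq_one (h : IsAtomicMonoid M) {l : List M}
    (hl : ∀ a ∈ l, IsMonoidAtom a) (hprod : l.prod = 1) : l = [] := by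
  obtain ⟨n, hn⟩ := h.norm_finite 1
  have hlength := hn (List.replicate (n + 1) l).flatten
    (fun a ha => by
      obtain ⟨k, hk, hak⟩ := List.mem_flatten.1 ha
      exact hl a (List.eq_of_mem_replicate hk ▸ hak))
    (by simp [List.prod_flatten, hprod])
  rw [List.length_flatten, List.map_replicate, List.sum_replicate, smul_eq_mul] at hlength
  refine List.eq_nil_of_length_eq_zero ?_
  by_contra hpos
  exact absurd hlength (not_le.2 (Nat.lt_of_lt_of_le n.lt_succ_self
    (Nat.le_mul_of_pos_right _ (Nat.pos_of_ne_zero hpos))))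

theorem IsAtomicMonoid.subsingleton_units (h : IsAtomicMonoid M) : Subsingleton Mˣ := by
  refine subsingleton_of_forall_eq 1 fun x => Units.ext ?_
  obtain ⟨l, hl, hlx⟩ := h.exists_list x.1
  obtain ⟨l', hl', hlx'⟩ := h.exists_list x.2
  have hnil := h.eq_nil_of_prod_eq_one (l := l ++ l')
    (List.forall_mem_append.2 ⟨hl, hl'⟩) (by simp [hlx, hlx'])
  rw [← hlx, (List.append_eq_nil_iff.1 hnil).1, List.prod_nil, Units.val_one]

theorem IsGarsideMonoid.exists_isGerm (h : IsGarsideMonoid M) :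
    ∃ (n : ℕ) (ι : Fin n → M) (rc lc : Fin n → Fin n → Fin n) (e Δ : Fin n),
      IsGerm rc lc e Δ ∧ IsComplementPresentation rc e ι := by
  obtain ⟨hG, D, hD⟩ := h
  have := hG.cancel
  have := hG.atomic.subsingleton_units
  have : Subsingleton (Mᵐᵒᵖ)ˣ := Units.opEquiv.toEquiv.subsingleton
  obtain ⟨n, ι, hinj, hrange⟩ := hD.finite.fin_param
  have hmem (x : M) : x ∈ Set.range ι ↔ x ∣ D := by rw [hrange, Set.mem_ofPred_eq]
  obtain ⟨e, he⟩ := (hmem 1).2 (one_dvd D)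
  obtain ⟨Δ, rfl⟩ := (hmem D).2 dvd_rfl
  have hdvd (x : M) : x ∣ ι Δ ↔ x ∈ Set.range ι := (hmem x).symm
  have hdvd_op (x : Mᵐᵒᵖ) : x ∣ op (ι Δ) ↔ x ∣ᵣ op (ι Δ) :=
    rightDvd_iff_op_dvd_op.symm.trans
      ((hD.left_iff_right x.unop).symm.trans dvd_iff_op_rightDvd_op)
  have hmem_op (x : Mᵐᵒᵖ) : x ∣ op (ι Δ) ↔ x ∈ Set.range fun s => op (ι s) := by
    rw [hdvd_op, ← op_unop x, ← dvd_iff_op_rightDvd_op, hdvd]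
    simp only [Set.mem_range, op_inj]
  obtain ⟨rc, hrc⟩ := exists_isLcmComplement hG.right_lcm hinj hdvd hD.left_iff_right he
  obtain ⟨lc, hlc⟩ := exists_isLcmComplement (ι := fun s => op (ι s))
    (fun x y => (hG.left_lcm x.unop y.unop).imp' op fun z hz => isLeftLcm_iff_op.1 hz)
    (op_injective.comp hinj) hmem_op hdvd_op (congrArg op he)
  exact ⟨n, ι, rc, lc, e, Δ,
    ⟨hrc.isHalfGerm hdvd fun s t r hr => hlc.isQuotient (congrArg op hr),
      hlc.isHalfGerm hmem_op fun s t r hr => hrc.isQuotient (op_injective hr)⟩,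
    hrc.isComplementPresentation (hrange ▸ hD.closure_divisors)⟩

end GarsideGerm

attribute [local fun_prop] Primrec Primrec.id Primrec.const Primrec.comp Primrec.fst Primrec.snd
  Primrec.pair

section PrimitiveRecursion

variable {α β : Type*} [Primcodable α] [Primcodable β]

theorem primrec_cons {f : α → β} {g : α → List β} (hf : Primrec f) (hg : Primrec g) :
    Primrec fun a => f a :: g a :=
  Primrec.list_cons.comp hf hg

theorem primrec_append {f g : α → List β} (hf : Primrec f) (hg : Primrec g) :
    Primrec fun a => f a ++ g a :=
  Primrec.list_append.comp hf hg

theorem primrec_map {γ : Type*} [Primcodable γ] {f : α → List β} {g : α → β → γ}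
    (hf : Primrec f) (hg : Primrec fun x : α × β => g x.1 x.2) :
    Primrec fun a => (f a).map (g a) :=
  Primrec.list_map hf hg

theorem primrec_flatMap {γ : Type*} [Primcodable γ] {f : α → List β} {g : α → β → List γ}
    (hf : Primrec f) (hg : Primrec fun x : α × β => g x.1 x.2) :
    Primrec fun a => (f a).flatMap (g a) :=
  Primrec.list_flatMap hf hg

theorem primrec_getD {f : α → List β} {g : α → ℕ} {d : β} (hf : Primrec f) (hg : Primrec g) :
    Primrec fun a => (f a).getD (g a) d :=
  (Primrec.list_getD d).comp hf hg

theorem primrec_idxOf [DecidableEq β] {f : α → List β} {g : α → β} (hf : Primrec f)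
    (hg : Primrec g) : Primrec fun a => (f a).idxOf (g a) :=
  Primrec.list_idxOf.comp hg hf

end PrimitiveRecursion

attribute [local fun_prop] primrec_cons primrec_append primrec_map primrec_flatMap primrec_getD
  primrec_idxOf

section BoundedQuantifiers

variable {α β : Type*} [Primcodable α] [Primcodable β]

theorem primrecPred_forall_mem {p : α → β → Prop} (hp : PrimrecPred fun x : α × β => p x.1 x.2)
    {f : α → List β} (hf : Primrec f) : PrimrecPred fun a => ∀ b ∈ f a, p a b :=
  (PrimrecRel.forall_mem_list (R := fun b a => p a b)
    (hp.comp (Primrec.pair Primrec.snd Primrec.fst))).comp hf Primrec.id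

theorem primrecPred_exists_mem {p : α → β → Prop} (hp : PrimrecPred fun x : α × β => p x.1 x.2)
    {f : α → List β} (hf : Primrec f) : PrimrecPred fun a => ∃ b ∈ f a, p a b :=
  (PrimrecRel.exists_mem_list (R := fun b a => p a b)
    (hp.comp (Primrec.pair Primrec.snd Primrec.fst))).comp hf Primrec.id

theorem primrecPred_forall_lt {p : α → ℕ → Prop} (hp : PrimrecPred fun x : α × ℕ => p x.1 x.2)
    {f : α → ℕ} (hf : Primrec f) : PrimrecPred fun a => ∀ n < f a, p a n :=
  (primrecPred_forall_mem hp (Primrec.list_range.comp hf)).of_eq fun a => by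
    simp only [List.mem_range]

theorem primrecPred_exists_lt {p : α → ℕ → Prop} (hp : PrimrecPred fun x : α × ℕ => p x.1 x.2)
    {f : α → ℕ} (hf : Primrec f) : PrimrecPred fun a => ∃ n < f a, p a n :=
  (primrecPred_exists_mem hp (Primrec.list_range.comp hf)).of_eq fun a => by
    simp only [List.mem_range]

theorem primrecPred_mem {f : α → β} {g : α → List β} (hf : Primrec f) (hg : Primrec g) :
    PrimrecPred fun a => f a ∈ g a :=
  (primrecPred_exists_mem (p := fun a b => b = f a) (Primrec.eq.comp (by fun_prop) (by fun_prop))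
    hg).of_eq fun a => by simp only [exists_eq_right]

end BoundedQuantifiers

section SigmaOne

theorem exists_forall_mem_exists_lt_iff {ι : Type*} {l : List ι} {r : ι → ℕ → Prop} :
    (∃ n, ∀ b ∈ l, ∃ m < n, r b m) ↔ ∀ b ∈ l, ∃ m, r b m := by
  refine ⟨fun ⟨n, h⟩ b hb => (h b hb).imp fun m hm => hm.2, fun h => ?_⟩
  choose! m hm using h
  refine ⟨(l.map m).sum + 1, fun b hb => ⟨m b, ?_, hm b hb⟩⟩
  exact Nat.lt_succ_of_le (List.single_le_sum (fun _ _ => Nat.zero_le _) _ (List.mem_map_of_mem hb))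

variable {α β : Type*} [Primcodable α] [Primcodable β]

/-- The `Σ⁰₁` predicates: the projections of the primitive recursive relations. -/
def SigmaOne (p : α → Prop) : Prop :=
  ∃ r : α → ℕ → Prop, PrimrecRel r ∧ ∀ a, p a ↔ ∃ n, r a n

theorem SigmaOne.of_eq {p q : α → Prop} (hp : SigmaOne p) (h : ∀ a, p a ↔ q a) :
    SigmaOne q := by
  obtain ⟨r, hr, hpr⟩ := hp
  exact ⟨r, hr, fun a => (h a).symm.trans (hpr a)⟩

theorem SigmaOne.of_primrecPred {p : α → Prop} (hp : PrimrecPred p) : SigmaOne p :=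
  ⟨fun a _ => p a, hp.comp Primrec.fst, fun a => by simp⟩

theorem SigmaOne.comp {p : β → Prop} (hp : SigmaOne p) {f : α → β} (hf : Primrec f) :
    SigmaOne fun a => p (f a) := by
  obtain ⟨r, hr, hpr⟩ := hp
  exact ⟨fun a n => r (f a) n, hr.comp (by fun_prop) Primrec.snd, fun a => hpr (f a)⟩

theorem SigmaOne.comp₃ {γ δ : Type*} [Primcodable γ] [Primcodable δ] {p : β → γ → δ → Prop}
    (hp : SigmaOne fun x : β × γ × δ => p x.1 x.2.1 x.2.2) {f : α → β} {g : α → γ} {k : α → δ}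
    (hf : Primrec f) (hg : Primrec g) (hk : Primrec k) : SigmaOne fun a => p (f a) (g a) (k a) :=
  hp.comp (hf.pair (hg.pair hk))

theorem sigmaOne_exists_of_primrecRel {r : α → β → Prop} (hr : PrimrecRel r) :
    SigmaOne fun a => ∃ b, r a b := by
  have hdecode : Primrec fun x : α × ℕ => (Encodable.decode x.2 : Option β) :=
    Primrec.decode.comp Primrec.snd
  refine ⟨fun a n => ∃ b ∈ (Encodable.decode n : Option β).toList, r a b, ?_, fun a => ?_⟩
  · exact primrecPred_exists_mem (p := fun (x : α × ℕ) b => r x.1 b)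
      (hr.comp (by fun_prop) Primrec.snd) (Primrec.optionToList.comp hdecode)
  · simp only [Option.mem_toList]
    exact ⟨fun ⟨b, hb⟩ => ⟨Encodable.encode b, b, Encodable.encodek b, hb⟩,
      fun ⟨_, b, _, hb⟩ => ⟨b, hb⟩⟩

theorem SigmaOne.and {p q : α → Prop} (hp : SigmaOne p) (hq : SigmaOne q) :
    SigmaOne fun a => p a ∧ q a := by
  obtain ⟨r, hr, hpr⟩ := hp
  obtain ⟨s, hs, hqs⟩ := hq
  have h : PrimrecRel fun (a : α) (x : ℕ × ℕ) => r a x.1 ∧ s a x.2 :=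
    (hr.comp (by fun_prop) (by fun_prop)).and (hs.comp (by fun_prop) (by fun_prop))
  exact (sigmaOne_exists_of_primrecRel h).of_eq fun a => by simp [hpr, hqs]

theorem SigmaOne.or {p q : α → Prop} (hp : SigmaOne p) (hq : SigmaOne q) :
    SigmaOne fun a => p a ∨ q a := by
  obtain ⟨r, hr, hpr⟩ := hp
  obtain ⟨s, hs, hqs⟩ := hq
  exact ⟨fun a n => r a n ∨ s a n, PrimrecPred.or hr hs, fun a => by
    simp only [hpr, hqs, exists_or]⟩

theorem sigmaOne_exists {p : α → β → Prop} (hp : SigmaOne fun x : α × β => p x.1 x.2) :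
    SigmaOne fun a => ∃ b, p a b := by
  obtain ⟨r, hr, hpr⟩ := hp
  have h : PrimrecRel fun (a : α) (x : β × ℕ) => r (a, x.1) x.2 :=
    hr.comp (by fun_prop) (by fun_prop)
  exact (sigmaOne_exists_of_primrecRel h).of_eq fun a => by simp [← hpr]

theorem sigmaOne_forall_mem {p : α → β → Prop} (hp : SigmaOne fun x : α × β => p x.1 x.2)
    {f : α → List β} (hf : Primrec f) : SigmaOne fun a => ∀ b ∈ f a, p a b := by
  obtain ⟨r, hr, hpr⟩ := hp
  have h : PrimrecRel fun (a : α) (n : ℕ) => ∀ b ∈ f a, ∃ m < n, r (a, b) m :=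
    primrecPred_forall_mem
      (p := fun (x : α × ℕ) b => ∃ m < x.2, r (x.1, b) m)
      (primrecPred_exists_lt (p := fun (y : (α × ℕ) × β) m => r (y.1.1, y.2) m)
        (hr.comp (by fun_prop) (by fun_prop)) (by fun_prop)) (by fun_prop)
  exact ⟨_, h, fun a => by simp only [exists_forall_mem_exists_lt_iff, ← hpr]⟩

theorem foldl_ite_eq_iff_reflTransGen {ι κ : Type*} {r : ι → ι → κ → Prop}
    [∀ y z k, Decidable (r y z k)] {u v : ι} :
    (∃ D : List (ι × κ), D.foldl (fun y z => if r y z.1 z.2 then z.1 else y) u = v) ↔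
      Relation.ReflTransGen (fun y z => ∃ k, r y z k) u v := by
  constructor
  · rintro ⟨D, rfl⟩
    induction D generalizing u with
    | nil => exact .refl
    | cons z D ih =>
      rw [List.foldl_cons]
      split_ifs with hz
      exacts [ih.head ⟨z.2, hz⟩, ih]
  · intro h
    induction h using Relation.ReflTransGen.head_induction_on with
    | refl => exact ⟨[], rfl⟩
    | head h _ ih =>
      obtain ⟨k, hk⟩ := h
      obtain ⟨D, hD⟩ := ih
      exact ⟨(_, k) :: D, by rw [List.foldl_cons, if_pos hk, hD]⟩

theorem sigmaOne_reflTransGen {r : α → β → β → Prop}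
    (hr : SigmaOne fun x : α × β × β => r x.1 x.2.1 x.2.2) :
    SigmaOne fun x : α × β × β => Relation.ReflTransGen (r x.1) x.2.1 x.2.2 := by
  classical
  obtain ⟨q, hq, hrq⟩ := hr
  have hstep : Primrec₂ fun (x : (α × β × β) × List (β × ℕ)) (y : β × β × ℕ) =>
      if q (x.1.1, y.1, y.2.1) y.2.2 then y.2.1 else y.1 :=
    Primrec.ite (hq.comp (by fun_prop) (by fun_prop)) (by fun_prop) (by fun_prop)
  have h : PrimrecRel fun (x : α × β × β) (D : List (β × ℕ)) =>
      D.foldl (fun y z => if q (x.1, y, z.1) z.2 then z.1 else y) x.2.1 = x.2.2 :=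
    Primrec.eq.comp (Primrec.list_foldl Primrec.snd (by fun_prop) hstep) (by fun_prop)
  refine (sigmaOne_exists_of_primrecRel h).of_eq fun x => ?_
  rw [foldl_ite_eq_iff_reflTransGen (r := fun y z k => q (x.1, y, z) k)]
  simp only [← hrq]

theorem SigmaOne.rePred {p : α → Prop} (hp : SigmaOne p) : REPred p := by
  classical
  obtain ⟨r, hr, hpr⟩ := hp
  have h : Partrec fun a => Nat.rfind fun n => (Part.some (decide (r a n)) : Part Bool) :=
    Partrec.rfind hr.decide.to_comp.partrec₂
  exact h.dom_re.of_eq fun a => Nat.rfind_dom.trans (by simp [hpr])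

theorem SigmaOne.exists_computable_range {p : α → Prop} (hp : SigmaOne p) (h : ∃ a, p a) :
    ∃ f : ℕ → α, Computable f ∧ Set.range f = {a | p a} := by
  classical
  obtain ⟨r, hr, hpr⟩ := hp
  obtain ⟨a₀, h₀⟩ := h
  let g (x : α × ℕ) : α := if r x.1 x.2 then x.1 else a₀
  have hg : Primrec g := Primrec.ite hr Primrec.fst (Primrec.const a₀)
  refine ⟨fun n => ((Encodable.decode n).map g).getD a₀,
    (Primrec.option_getD.comp (Primrec.option_map Primrec.decode (hg.comp Primrec.snd).to₂)
      (Primrec.const a₀)).to_comp, Set.Subset.antisymm ?_ fun a ha => ?_⟩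
  · rintro _ ⟨n, rfl⟩
    have hgp (x : α × ℕ) : p (g x) := by
      by_cases hx : r x.1 x.2
      · simpa only [g, if_pos hx] using (hpr x.1).2 ⟨x.2, hx⟩
      · simpa only [g, if_neg hx] using h₀
    change p (((Encodable.decode n).map g).getD a₀)
    cases (Encodable.decode n : Option (α × ℕ)) with
    | none => exact h₀
    | some x => exact hgp x
  · obtain ⟨n, hn⟩ := (hpr a).1 ha
    exact ⟨Encodable.encode (a, n), by simp [g, hn]⟩

end SigmaOne

section Congruence

open Relation

variable {M : Type*} [Monoid M] {r : M → M → Prop}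

/-- `y` is obtained from `x` by replacing one factor by another one related to it by `r`. -/
def ContextStep (r : M → M → Prop) (x y : M) : Prop :=
  ∃ u v a b, r u v ∧ x = a * u * b ∧ y = a * v * b

theorem eqvGen_contextStep_mul_mul {x y : M} (h : EqvGen (ContextStep r) x y) (a b : M) :
    EqvGen (ContextStep r) (a * x * b) (a * y * b) := by
  induction h with
  | rel x y h =>
    obtain ⟨u, v, c, d, huv, rfl, rfl⟩ := h
    exact .rel _ _ ⟨u, v, a * c, d * b, huv, by simp only [mul_assoc], by simp only [mul_assoc]⟩
  | refl => exact .refl _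
  | symm _ _ _ ih => exact .symm _ _ ih
  | trans _ _ _ _ _ ih₁ ih₂ => exact .trans _ _ _ ih₁ ih₂

theorem conGen_iff_eqvGen_contextStep {x y : M} :
    conGen r x y ↔ EqvGen (ContextStep r) x y := by
  constructor
  · intro h
    induction h with
    | of x y h => exact .rel _ _ ⟨x, y, 1, 1, h, by simp, by simp⟩
    | refl => exact .refl _
    | symm _ ih => exact .symm _ _ ih
    | @mul w x y z _ _ ih₁ ih₂ =>
      have h₁ := eqvGen_contextStep_mul_mul ih₁ 1 y
      have h₂ := eqvGen_contextStep_mul_mul ih₂ x 1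
      simp only [one_mul, mul_one] at h₁ h₂
      exact .trans _ _ _ h₁ h₂
    | trans _ _ ih₁ ih₂ => exact .trans _ _ _ ih₁ ih₂
  · intro h
    induction h with
    | rel x y h =>
      obtain ⟨u, v, a, b, huv, rfl, rfl⟩ := h
      exact (conGen r).mul ((conGen r).mul ((conGen r).refl a) (.of _ _ huv)) ((conGen r).refl b)
    | refl => exact (conGen r).refl _
    | symm _ _ _ ih => exact (conGen r).symm ih
    | trans _ _ _ _ _ ih₁ ih₂ => exact (conGen r).trans ih₁ ih₂

end Congruence

section FinitePresentation

variable {α M : Type*} [Monoid M] {gens : List α} {rels : List (List α × List α)}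
  {π : FreeMonoid α →* M}

/-- The relations `rels`, together with the relations `a = 1` for the letters `a` outside `gens`:
this makes a presentation on the generators `gens` a presentation on all the letters. -/
def WordRelation (gens : List α) (rels : List (List α × List α)) (u v : FreeMonoid α) : Prop :=
  (u.toList, v.toList) ∈ rels ∨ ∃ a ∉ gens, u = .of a ∧ v = 1

/-- `π` exhibits `M` as the monoid presented by the generators `gens` and the relations `rels`; the
letters outside `gens` represent `1`. -/
structure IsFinitePresentation (gens : List α) (rels : List (List α × List α))
    (π : FreeMonoid α →* M) : Prop where
  surjective : Function.Surjective π
  ker_eq : Con.ker π = conGen (WordRelation gens rels)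

theorem wordRelation_le_ker {N : Type*} [Monoid N] {Φ : FreeMonoid α →* N}
    (hgens : ∀ a ∉ gens, Φ (.of a) = 1) (hrels : ∀ r ∈ rels, Φ (.ofList r.1) = Φ (.ofList r.2)) :
    WordRelation gens rels ≤ ⇑(Con.ker Φ) := by
  rintro u v (h | ⟨a, ha, rfl, rfl⟩)
  · exact hrels _ h
  · exact (hgens a ha).trans (map_one Φ).symm

theorem IsFinitePresentation.of_section (hsurj : Function.Surjective π)
    (hgens : ∀ a ∉ gens, π (.of a) = 1) (hrels : ∀ r ∈ rels, π (.ofList r.1) = π (.ofList r.2))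
    (F : M →* (conGen (WordRelation gens rels)).Quotient)
    (hF : ∀ a, F (π (.of a)) = (.of a : FreeMonoid α)) :
    IsFinitePresentation gens rels π where
  surjective := hsurj
  ker_eq := by
    refine le_antisymm (fun u v h => ?_) (Con.conGen_le.2 (wordRelation_le_ker hgens hrels))
    have hcomp : F.comp π = (conGen (WordRelation gens rels)).mk' := FreeMonoid.hom_eq hF
    refine (Con.eq _).1 ?_
    rw [← Con.coe_mk', ← hcomp]
    exact congrArg F h

namespace IsFinitePresentation

theorem eq_of_mem (h : IsFinitePresentation gens rels π) {r : List α × List α} (hr : r ∈ rels) :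
    π (.ofList r.1) = π (.ofList r.2) := by
  have hker : Con.ker π (.ofList r.1) (.ofList r.2) := h.ker_eq ▸ .of _ _ (.inl hr)
  exact hker

theorem eq_one_of_notMem (h : IsFinitePresentation gens rels π) {a : α} (ha : a ∉ gens) :
    π (.of a) = 1 := by
  have hker : Con.ker π (.of a) 1 := h.ker_eq ▸ .of _ _ (.inr ⟨a, ha, rfl, rfl⟩)
  exact hker.trans (map_one π)

theorem exists_lift (h : IsFinitePresentation gens rels π) {N : Type*} [Monoid N]
    {Φ : FreeMonoid α →* N} (hgens : ∀ a ∉ gens, Φ (.of a) = 1)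
    (hrels : ∀ r ∈ rels, Φ (.ofList r.1) = Φ (.ofList r.2)) :
    ∃ F : M →* N, F.comp π = Φ := by
  have hle : Con.ker π ≤ Con.ker Φ := h.ker_eq ▸ Con.conGen_le.2 (wordRelation_le_ker hgens hrels)
  let q := Con.quotientKerEquivOfSurjective π h.surjective
  refine ⟨((Con.ker π).lift Φ hle).comp q.symm.toMonoidHom, MonoidHom.ext fun w => ?_⟩
  have hq : q.symm (π w) = (w : (Con.ker π).Quotient) := q.symm_apply_eq.2 rfl
  simp [hq]

theorem hom_ext (h : IsFinitePresentation gens rels π) {N : Type*} [Monoid N] {F G : M →* N}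
    (hFG : ∀ a ∈ gens, F (π (.of a)) = G (π (.of a))) : F = G := by
  refine (MonoidHom.cancel_right h.surjective).1 (FreeMonoid.hom_eq fun a => ?_)
  by_cases ha : a ∈ gens
  · exact hFG a ha
  · simp only [MonoidHom.comp_apply, h.eq_one_of_notMem ha, map_one]

end IsFinitePresentation

end FinitePresentation

section Substitution

variable {α : Type*} [DecidableEq α]

/-- The endomorphism of the free monoid that replaces the `i`-th letter of `L` by the `i`-th word of
`V`, and the letters to which no word corresponds by `1`. -/
def subst (L : List α) (V : List (List α)) : FreeMonoid α →* FreeMonoid α :=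
  FreeMonoid.lift fun a => .ofList (V.getD (L.idxOf a) [])

theorem subst_ofList (L : List α) (V : List (List α)) (w : List α) :
    subst L V (.ofList w) = .ofList (w.flatMap fun a => V.getD (L.idxOf a) []) := by
  rw [subst, FreeMonoid.lift_ofList, List.flatMap_def, FreeMonoid.ofList_flatten, List.map_map]
  rfl

theorem subst_of_notMem {L : List α} {V : List (List α)} (hV : V.length ≤ L.length) {a : α}
    (ha : a ∉ L) : subst L V (.of a) = 1 := by
  simp [subst, List.idxOf_of_notMem ha, hV]

theorem subst_map_of_mem {L : List α} (f : α → List α) {a : α} (ha : a ∈ L) :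
    subst L (L.map f) (.of a) = .ofList (f a) := by
  simp [subst, ha]

variable {M N : Type*} [Monoid M] [Monoid N] {gens gens' : List α}
  {rels rels' : List (List α × List α)} {π : FreeMonoid α →* M} {π' : FreeMonoid α →* N}

/-- Substituting the words of `V` for the generators `gens` turns the relations `rels` into
equalities in the monoid represented by `π'`: hence `V` encodes a homomorphism from the monoid with
the presentation `gens`, `rels` to that monoid. -/
def EncodesHom (gens : List α) (rels : List (List α × List α)) (π' : FreeMonoid α →* N)
    (V : List (List α)) : Prop :=
  V.length ≤ gens.length ∧
    ∀ r ∈ rels, π' (subst gens V (.ofList r.1)) = π' (subst gens V (.ofList r.2))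

theorem EncodesHom.exists_hom {V : List (List α)} (hV : EncodesHom gens rels π' V)
    (h : IsFinitePresentation gens rels π) :
    ∃ F : M →* N, F.comp π = π'.comp (subst gens V) :=
  h.exists_lift (fun a ha => by simp [subst_of_notMem hV.1 ha]) hV.2

theorem exists_encodesHom (h : IsFinitePresentation gens rels π)
    (h' : IsFinitePresentation gens' rels' π') (F : M →* N) :
    ∃ V, EncodesHom gens rels π' V ∧ F.comp π = π'.comp (subst gens V) := by
  choose w hw using fun a => h'.surjective (F (π (.of a)))
  have hcomp : F.comp π = π'.comp (subst gens (gens.map fun a => (w a).toList)) := by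
    refine FreeMonoid.hom_eq fun a => ?_
    by_cases ha : a ∈ gens
    · simp [subst_map_of_mem _ ha, hw]
    · simp [subst_of_notMem (List.length_map _).le ha, h.eq_one_of_notMem ha]
  refine ⟨_, ⟨(List.length_map _).le, fun r hr => ?_⟩, hcomp⟩
  rw [← MonoidHom.comp_apply, ← MonoidHom.comp_apply, ← hcomp, MonoidHom.comp_apply, h.eq_of_mem hr,
    MonoidHom.comp_apply]

theorem nonempty_mulEquiv_iff_exists_encodesHom (h : IsFinitePresentation gens rels π)
    (h' : IsFinitePresentation gens' rels' π') :
    Nonempty (M ≃* N) ↔ ∃ V W, (EncodesHom gens rels π' V ∧ EncodesHom gens' rels' π W) ∧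
      (∀ a ∈ gens, π (subst gens' W (subst gens V (.of a))) = π (.of a)) ∧
      ∀ a ∈ gens', π' (subst gens V (subst gens' W (.of a))) = π' (.of a) := by
  constructor
  · rintro ⟨φ⟩
    obtain ⟨V, hV, hφV⟩ := exists_encodesHom h h' φ.toMonoidHom
    obtain ⟨W, hW, hφW⟩ := exists_encodesHom h' h φ.symm.toMonoidHom
    have hV' w : φ (π w) = π' (subst gens V w) := DFunLike.congr_fun hφV w
    have hW' w : φ.symm (π' w) = π (subst gens' W w) := DFunLike.congr_fun hφW w
    exact ⟨V, W, ⟨hV, hW⟩, fun a _ => by rw [← hW', ← hV', φ.symm_apply_apply],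
      fun a _ => by rw [← hV', ← hW', φ.apply_symm_apply]⟩
  · rintro ⟨V, W, ⟨hV, hW⟩, hWV, hVW⟩
    obtain ⟨F, hF⟩ := hV.exists_hom h
    obtain ⟨G, hG⟩ := hW.exists_hom h'
    have hF' w : F (π w) = π' (subst gens V w) := DFunLike.congr_fun hF w
    have hG' w : G (π' w) = π (subst gens' W w) := DFunLike.congr_fun hG w
    refine ⟨F.toMulEquiv G (h.hom_ext fun a ha => ?_) (h'.hom_ext fun a ha => ?_)⟩
    · simp only [MonoidHom.comp_apply, MonoidHom.id_apply, hF', hG', hWV a ha]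
    · simp only [MonoidHom.comp_apply, MonoidHom.id_apply, hF', hG', hVW a ha]

end Substitution

section Computability

variable {A α : Type*} [Primcodable A] [Primcodable α]

instance : Primcodable (FreeMonoid α) := inferInstanceAs (Primcodable (List α))

theorem primrec_toList {f : A → FreeMonoid α} (hf : Primrec f) : Primrec fun x => (f x).toList := hf

theorem primrec_ofList {f : A → List α} (hf : Primrec f) :
    Primrec fun x => FreeMonoid.ofList (f x) := hf

theorem primrec_of {f : A → α} (hf : Primrec f) : Primrec fun x => FreeMonoid.of (f x) :=
  primrec_ofList (Primrec.list_cons.comp hf (Primrec.const []))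

theorem primrec_freeMonoid_mul {f g : A → FreeMonoid α} (hf : Primrec f) (hg : Primrec g) :
    Primrec fun x => f x * g x :=
  Primrec.list_append.comp hf hg

attribute [local fun_prop] primrec_toList primrec_ofList primrec_of primrec_freeMonoid_mul

theorem primrec_subst [DecidableEq α] {L : A → List α} {V : A → List (List α)}
    {w : A → FreeMonoid α} (hL : Primrec L) (hV : Primrec V) (hw : Primrec w) :
    Primrec fun x => subst (L x) (V x) (w x) := by
  have h : Primrec fun x => FreeMonoid.ofList
      ((w x).toList.flatMap fun a => (V x).getD ((L x).idxOf a) []) := by fun_prop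
  exact h.of_eq fun x => (subst_ofList (L x) (V x) (w x).toList).symm

attribute [local fun_prop] primrec_subst

theorem sigmaOne_wordRelation {gens : A → List α} {rels : A → List (List α × List α)}
    (hgens : Primrec gens) (hrels : Primrec rels) :
    SigmaOne fun x : A × FreeMonoid α × FreeMonoid α =>
      WordRelation (gens x.1) (rels x.1) x.2.1 x.2.2 := by
  refine .or (.of_primrecPred (primrecPred_mem (by fun_prop) (by fun_prop)))
    (sigmaOne_exists (.of_primrecPred (.and ?_ (.and ?_ ?_))))
  · exact .not (primrecPred_mem (by fun_prop) (by fun_prop))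
  · exact Primrec.eq.comp (by fun_prop) (by fun_prop)
  · exact Primrec.eq.comp (by fun_prop) (by fun_prop)

theorem sigmaOne_contextStep {r : A → FreeMonoid α → FreeMonoid α → Prop}
    (hr : SigmaOne fun x : A × FreeMonoid α × FreeMonoid α => r x.1 x.2.1 x.2.2) :
    SigmaOne fun x : A × FreeMonoid α × FreeMonoid α => ContextStep (r x.1) x.2.1 x.2.2 := by
  refine sigmaOne_exists (sigmaOne_exists (sigmaOne_exists (sigmaOne_exists (.and ?_
    (.of_primrecPred (.and ?_ ?_))))))
  · exact hr.comp₃ (by fun_prop) (by fun_prop) (by fun_prop)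
  · exact Primrec.eq.comp (by fun_prop) (by fun_prop)
  · exact Primrec.eq.comp (by fun_prop) (by fun_prop)

theorem sigmaOne_conGen {r : A → FreeMonoid α → FreeMonoid α → Prop}
    (hr : SigmaOne fun x : A × FreeMonoid α × FreeMonoid α => r x.1 x.2.1 x.2.2) :
    SigmaOne fun x : A × FreeMonoid α × FreeMonoid α => conGen (r x.1) x.2.1 x.2.2 := by
  have hstep := sigmaOne_contextStep hr
  have hsymm : SigmaOne fun x : A × FreeMonoid α × FreeMonoid α =>
      Relation.SymmGen (ContextStep (r x.1)) x.2.1 x.2.2 :=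
    hstep.or (SigmaOne.comp₃ (p := fun a => ContextStep (r a)) hstep
      (by fun_prop) (by fun_prop) (by fun_prop))
  refine (sigmaOne_reflTransGen (r := fun a => Relation.SymmGen (ContextStep (r a)))
    hsymm).of_eq fun x => ?_
  rw [Relation.EqvGen.reflTransGen_symmGen, conGen_iff_eqvGen_contextStep]

section Family

variable {M : A → Type*} [∀ a, Monoid (M a)] {gens : A → List α} {rels : A → List (List α × List α)}
  {π : ∀ a, FreeMonoid α →* M a} {B : Type*} [Primcodable B]

theorem sigmaOne_eval_eq (h : ∀ a, IsFinitePresentation (gens a) (rels a) (π a))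
    (hgens : Primrec gens) (hrels : Primrec rels) {f : B → A} {u v : B → FreeMonoid α}
    (hf : Primrec f) (hu : Primrec u) (hv : Primrec v) :
    SigmaOne fun b => π (f b) (u b) = π (f b) (v b) := by
  refine SigmaOne.of_eq (SigmaOne.comp₃ (p := fun a => conGen (WordRelation (gens a) (rels a)))
    (sigmaOne_conGen (r := fun a => WordRelation (gens a) (rels a))
      (sigmaOne_wordRelation hgens hrels)) hf hu hv) fun b => ?_
  rw [← (h (f b)).ker_eq, Con.ker_rel]

theorem sigmaOne_encodesHom [DecidableEq α] (h : ∀ a, IsFinitePresentation (gens a) (rels a) (π a))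
    (hgens : Primrec gens) (hrels : Primrec rels) {f g : B → A} {V : B → List (List α)}
    (hf : Primrec f) (hg : Primrec g) (hV : Primrec V) :
    SigmaOne fun b => EncodesHom (gens (f b)) (rels (f b)) (π (g b)) (V b) :=
  .and (.of_primrecPred (Primrec.nat_le.comp (Primrec.list_length.comp hV)
    (Primrec.list_length.comp (hgens.comp hf)))) (sigmaOne_forall_mem
      (sigmaOne_eval_eq h hgens hrels (by fun_prop) (by fun_prop) (by fun_prop)) (by fun_prop))

theorem sigmaOne_nonempty_mulEquiv (h : ∀ a, IsFinitePresentation (gens a) (rels a) (π a))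
    (hgens : Primrec gens) (hrels : Primrec rels) {f g : B → A} (hf : Primrec f) (hg : Primrec g) :
    SigmaOne fun b => Nonempty (M (f b) ≃* M (g b)) := by
  classical
  refine SigmaOne.of_eq ?_ fun b =>
    (nonempty_mulEquiv_iff_exists_encodesHom (h (f b)) (h (g b))).symm
  refine sigmaOne_exists (sigmaOne_exists (.and (.and ?_ ?_) (.and ?_ ?_)))
  · exact sigmaOne_encodesHom h hgens hrels (by fun_prop) (by fun_prop) (by fun_prop)
  · exact sigmaOne_encodesHom h hgens hrels (by fun_prop) (by fun_prop) (by fun_prop)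
  all_goals
    exact sigmaOne_forall_mem (sigmaOne_eval_eq h hgens hrels (by fun_prop) (by fun_prop)
      (by fun_prop)) (by fun_prop)

end Family

end Computability

namespace MonoidPresentation

variable (P : MonoidPresentation)

/-- The element of the presented monoid represented by a word, where the letters that are not
generators represent `1`. -/
def eval : FreeMonoid ℕ →* P.toMonoid :=
  FreeMonoid.lift fun i => if hi : i < P.1.1 then .of P.rels ⟨i, hi⟩ else 1

theorem eval_val (i : Fin P.1.1) : P.eval (.of i.val) = .of P.rels i := by
  simp [eval]

theorem eval_map_val (u : FreeMonoid (Fin P.1.1)) :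
    P.eval (u.map Fin.val) = PresentedMonoid.mk P.rels u :=
  DFunLike.congr_fun (f := P.eval.comp (FreeMonoid.map Fin.val)) (FreeMonoid.hom_eq P.eval_val) u

theorem eval_ofList_eq {r : List ℕ × List ℕ} (hr : r ∈ P.1.2) :
    P.eval (.ofList r.1) = P.eval (.ofList r.2) := by
  have hmap {w : List ℕ} (hw : WordBelow P.1.1 w) :
      ∃ u : FreeMonoid (Fin P.1.1), u.map Fin.val = .ofList w :=
    ⟨.ofList (w.pmap Fin.mk fun a ha => hw a ha),
      congrArg FreeMonoid.ofList (by simp [List.map_pmap])⟩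
  obtain ⟨u, hu⟩ := hmap (P.2 r hr).1
  obtain ⟨v, hv⟩ := hmap (P.2 r hr).2
  rw [← hu, ← hv, eval_map_val, eval_map_val]
  refine PresentedMonoid.mk_eq_mk_of_rel ?_
  rwa [rels, ← FreeMonoid.toList_map, ← FreeMonoid.toList_map, hu, hv]

theorem isFinitePresentation_eval : IsFinitePresentation (List.range P.1.1) P.1.2 P.eval := by
  let F : P.toMonoid →* (conGen (WordRelation (List.range P.1.1) P.1.2)).Quotient :=
    Con.lift _ ((Con.mk' _).comp (FreeMonoid.map Fin.val)) <|
      Con.conGen_le.2 fun u v huv => (Con.eq _).2 (.of _ _ (.inl huv))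
  refine .of_section (fun x => ?_) (fun a ha => ?_) (fun r hr => P.eval_ofList_eq hr) F
    fun a => ?_
  · obtain ⟨u, rfl⟩ := PresentedMonoid.surjective_mk x
    exact ⟨_, P.eval_map_val u⟩
  · simp_all [eval]
  · by_cases ha : a < P.1.1
    · rw [P.eval_val ⟨a, ha⟩]
      rfl
    · rw [eval, FreeMonoid.lift_eval_of, dif_neg ha, map_one]
      exact (Con.eq _).2 (.symm (.of _ _ (.inr ⟨a, by simpa using ha, rfl, rfl⟩)))

end MonoidPresentation

theorem val_freeGroup_lift_mk {α N : Type*} [Monoid N] {q : FreeMonoid (α × Bool) →* N}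
    {g : α → Nˣ} (hg : ∀ i, q (.of (i, true)) = g i) (hg' : ∀ i, q (.of (i, false)) = ↑(g i)⁻¹)
    (u : List (α × Bool)) : (FreeGroup.lift g (.mk u) : N) = q (.ofList u) := by
  rw [FreeGroup.lift_mk]
  induction u with
  | nil => simp
  | cons a u ih => rcases a with ⟨i, _ | _⟩ <;> simp [FreeMonoid.ofList_cons, hg, hg', ih]

namespace GroupPresentation

variable (P : GroupPresentation)

/-- The generators of a finite group presentation and their formal inverses, which are the
generators of the presented group as a monoid. -/
def letters : List (ℕ × Bool) := List.range P.1.1 ×ˢ [true, false]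

/-- The monoid relations of a presented group on the generators and their formal inverses. -/
def monoidRels : List (List (ℕ × Bool) × List (ℕ × Bool)) :=
  P.1.2 ++ P.letters.map fun a => ([a, (a.1, !a.2)], [])

theorem mem_letters {a : ℕ × Bool} : a ∈ P.letters ↔ a.1 < P.1.1 := by
  rcases a with ⟨i, _ | _⟩ <;> simp [letters, SProd.sprod]

/-- The element of the presented group represented by a word in the generators and their formal
inverses, where the letters that are neither represent `1`. -/
def eval : FreeMonoid (ℕ × Bool) →* P.toGroup :=
  FreeMonoid.lift fun a =>
    if ha : a.1 < P.1.1 then PresentedGroup.mk P.rels (.mk [(⟨a.1, ha⟩, a.2)]) else 1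

theorem eval_of {a : ℕ × Bool} (ha : a.1 < P.1.1) :
    P.eval (.of a) = PresentedGroup.mk P.rels (.mk [(⟨a.1, ha⟩, a.2)]) := by
  simp [eval, ha]

theorem eval_map_val (u : List (Fin P.1.1 × Bool)) :
    P.eval (.ofList (u.map (Prod.map Fin.val id))) = PresentedGroup.mk P.rels (.mk u) := by
  induction u with
  | nil => rfl
  | cons a u ih =>
    rw [List.map_cons, FreeMonoid.ofList_cons, map_mul, ih, P.eval_of a.1.2, ← map_mul,
      FreeGroup.mul_mk]
    rfl

theorem eval_ofList_eq {r : List (ℕ × Bool) × List (ℕ × Bool)} (hr : r ∈ P.1.2) :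
    P.eval (.ofList r.1) = P.eval (.ofList r.2) := by
  have hmap {w : List (ℕ × Bool)} (hw : SignedWordBelow P.1.1 w) :
      ∃ u : List (Fin P.1.1 × Bool), u.map (Prod.map Fin.val id) = w :=
    ⟨w.pmap (fun a (ha : a.1 < P.1.1) => (⟨a.1, ha⟩, a.2)) fun a ha => hw a ha,
      by simp [List.map_pmap]⟩
  obtain ⟨u, hu⟩ := hmap (P.2 r hr).1
  obtain ⟨v, hv⟩ := hmap (P.2 r hr).2
  rw [← hu, ← hv, eval_map_val, eval_map_val]
  exact PresentedGroup.mk_eq_mk_of_mul_inv_mem ⟨u, v, by rwa [hu, hv], rfl⟩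

theorem eval_mul_eval_not (a : ℕ × Bool) : P.eval (.of a) * P.eval (.of (a.1, !a.2)) = 1 := by
  by_cases ha : a.1 < P.1.1
  · rw [P.eval_of ha, P.eval_of (a := (a.1, !a.2)) ha, ← map_mul, FreeGroup.mul_mk]
    exact (congrArg _ (Quot.sound (FreeGroup.Red.Step.not (L₁ := [])))).trans (map_one _)
  · simp [eval, ha]

theorem exists_section : ∃ F : P.toGroup →* (conGen (WordRelation P.letters P.monoidRels)).Quotient,
    ∀ a, F (P.eval (.of a)) = (.of a : FreeMonoid (ℕ × Bool)) := by
  let q : FreeMonoid (ℕ × Bool) →* _ := (conGen (WordRelation P.letters P.monoidRels)).mk'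
  have hq {u v : List (ℕ × Bool)} (h : (u, v) ∈ P.monoidRels) : q (.ofList u) = q (.ofList v) :=
    (Con.eq _).2 (.of _ _ (.inl h))
  have hinv (i : Fin P.1.1) (b : Bool) : q (.of (i.val, b)) * q (.of (i.val, !b)) = 1 :=
    hq (List.mem_append_right _ (List.mem_map_of_mem (P.mem_letters.2 i.2)))
  let g (i : Fin P.1.1) : (conGen (WordRelation P.letters P.monoidRels)).Quotientˣ :=
    ⟨q (.of (i.val, true)), q (.of (i.val, false)), hinv i true, hinv i false⟩
  have hg (u : List (Fin P.1.1 × Bool)) :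
      FreeGroup.lift g (.mk u) = q (.ofList (u.map (Prod.map Fin.val id))) :=
    val_freeGroup_lift_mk (q := q.comp (FreeMonoid.map (Prod.map Fin.val id))) (fun _ => rfl)
      (fun _ => rfl) u
  have hrels : ∀ r ∈ P.rels, FreeGroup.lift g r = 1 := by
    rintro _ ⟨u, v, huv, rfl⟩
    rw [map_mul, map_inv, mul_inv_eq_one, Units.ext_iff, hg, hg]
    exact hq (List.mem_append_left _ huv)
  refine ⟨(Units.coeHom _).comp (PresentedGroup.toGroup hrels), fun a => ?_⟩
  by_cases ha : a.1 < P.1.1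
  · rw [P.eval_of ha]
    exact hg [(⟨a.1, ha⟩, a.2)]
  · rw [eval, FreeMonoid.lift_eval_of, dif_neg ha, map_one]
    exact (Con.eq _).2 (.symm (.of _ _ (.inr ⟨a, mt P.mem_letters.1 ha, rfl, rfl⟩)))

theorem isFinitePresentation_eval : IsFinitePresentation P.letters P.monoidRels P.eval := by
  obtain ⟨F, hF⟩ := P.exists_section
  refine .of_section (fun x => ?_) (fun a ha => ?_) (fun r hr => ?_) F hF
  · obtain ⟨x, rfl⟩ := PresentedGroup.mk_surjective _ x
    exact ⟨_, (P.eval_map_val x.toWord).trans (congrArg _ FreeGroup.mk_toWord)⟩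
  · simp_all [eval, mem_letters]
  · rcases List.mem_append.1 hr with hr | hr
    · exact P.eval_ofList_eq hr
    · obtain ⟨a, -, rfl⟩ := List.mem_map.1 hr
      exact P.eval_mul_eval_not a

end GroupPresentation

section Envelope

namespace MonoidPresentation

variable (Q : MonoidPresentation)

/-- The group presentation with the generators and relations of a monoid presentation: it presents
the enveloping group of the monoid. -/
def groupPresentation : GroupPresentation :=
  ⟨(Q.1.1, Q.1.2.map fun r => (r.1.map fun i => (i, true), r.2.map fun i => (i, true))), by
    simpa only [GroupPresentationOk, SignedWordBelow, List.forall_mem_map, MonoidPresentationOk,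
      WordBelow] using Q.2⟩

/-- The canonical homomorphism from a presented monoid to its enveloping group. -/
def toEnvelope : Q.toMonoid →* Q.groupPresentation.toGroup :=
  Con.lift _ ((Q.groupPresentation.eval.comp (FreeMonoid.map fun i => (i, true))).comp
    (FreeMonoid.map Fin.val)) <| Con.conGen_le.2 fun _ _ huv =>
      Q.groupPresentation.eval_ofList_eq (List.mem_map_of_mem huv)

theorem toEnvelope_of (i : Fin Q.1.1) :
    Q.toEnvelope (.of Q.rels i) = Q.groupPresentation.eval (.of (i.val, true)) :=
  rfl

theorem closure_range_toEnvelope : Subgroup.closure (Set.range Q.toEnvelope) = ⊤ := by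
  rw [eq_top_iff, ← PresentedGroup.closure_range_of, Subgroup.closure_le]
  rintro _ ⟨i, rfl⟩
  exact Subgroup.subset_closure
    ⟨.of _ i, (Q.toEnvelope_of i).trans (Q.groupPresentation.eval_of i.2)⟩

theorem exists_comp_toEnvelope_eq {H : Type*} [Group H] (f : Q.toMonoid →* H) :
    ∃ F : Q.groupPresentation.toGroup →* H, F.comp Q.toEnvelope = f := by
  let g (i : ℕ) : H := f (Q.eval (.of i))
  let Φ : FreeMonoid (ℕ × Bool) →* H := FreeMonoid.lift fun a => cond a.2 (g a.1) (g a.1)⁻¹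
  have hΦ : Φ.comp (FreeMonoid.map fun i => (i, true)) = f.comp Q.eval :=
    FreeMonoid.hom_eq fun i => by simp [Φ, g]
  have hΦ' (w : List ℕ) : Φ (.ofList (w.map fun i => (i, true))) = f (Q.eval (.ofList w)) :=
    DFunLike.congr_fun hΦ (.ofList w)
  have hgens (a) (ha : a ∉ Q.groupPresentation.letters) : Φ (.of a) = 1 := by
    have hg : g a.1 = 1 := by
      simp only [g, Q.isFinitePresentation_eval.eq_one_of_notMem
        (mt List.mem_range.1 (mt Q.groupPresentation.mem_letters.2 ha)), map_one]
    cases h : a.2 <;> simp [Φ, hg]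
  have hrels (r) (hr : r ∈ Q.groupPresentation.monoidRels) :
      Φ (.ofList r.1) = Φ (.ofList r.2) := by
    rcases List.mem_append.1 hr with hr | hr
    · obtain ⟨s, hs, rfl⟩ := List.mem_map.1 hr
      rw [hΦ', hΦ', Q.eval_ofList_eq hs]
    · obtain ⟨⟨i, b⟩, -, rfl⟩ := List.mem_map.1 hr
      cases b <;> simp [Φ, FreeMonoid.ofList_cons]
  obtain ⟨F, hF⟩ := Q.groupPresentation.isFinitePresentation_eval.exists_lift hgens hrels
  refine ⟨F, PresentedMonoid.ext _ fun i => ?_⟩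
  rw [MonoidHom.comp_apply, toEnvelope_of, ← MonoidHom.comp_apply, hF, ← Q.eval_val]
  exact hΦ' [i.val]

end MonoidPresentation

end Envelope

section Fractions

variable {M : Type*} [Monoid M]

theorem IsGaussianMonoid.exists_mul_left_eq (h : IsGaussianMonoid M) (x y : M) :
    ∃ a b, a * x = b * y := by
  obtain ⟨z, ⟨a, ha⟩, ⟨b, hb⟩, -⟩ := h.left_lcm x y
  exact ⟨a, b, ha.symm.trans hb⟩

theorem IsGaussianMonoid.exists_mul_right_eq (h : IsGaussianMonoid M) (x y : M) :
    ∃ a b, x * a = y * b := by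
  obtain ⟨z, ⟨a, ha⟩, ⟨b, hb⟩, -⟩ := h.right_lcm x y
  exact ⟨a, b, ha.symm.trans hb⟩

theorem exists_injective_hom_group {M : Type u} [Monoid M] [IsCancelMul M]
    (hM : ∀ x y : M, ∃ a b, a * x = b * y) :
    ∃ (H : Type u) (_ : Group H) (f : M →* H), Function.Injective f := by
  choose a b hab using hM
  let _ : OreLocalization.OreSet (⊤ : Submonoid M) :=
    { ore_right_cancel := fun r₁ r₂ s hs => ⟨1, by rw [mul_right_cancel hs]⟩
      oreNum := fun r s => b r s
      oreDenom := fun r s => ⟨a r s, trivial⟩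
      ore_eq := fun r s => hab r s }
  let f : M →* (OreLocalization (⊤ : Submonoid M) M)ˣ :=
    IsUnit.liftRight OreLocalization.numeratorHom fun x =>
      OreLocalization.numerator_isUnit (⟨x, trivial⟩ : (⊤ : Submonoid M))
  refine ⟨_, inferInstance, f, fun x y hxy => ?_⟩
  have hdiv : (x /ₒ 1 : OreLocalization (⊤ : Submonoid M) M) = y /ₒ 1 := congrArg Units.val hxy
  obtain ⟨u, v, huv, hdenom⟩ := OreLocalization.oreDiv_eq_iff.1 hdiv
  have huv' : (u : M) * y = v * x := huv
  have hvu : v = u := by simpa using hdenom.symm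
  exact (mul_left_cancel (hvu ▸ huv')).symm

variable {G : Type*} [Group G] {j : M →* G}

theorem exists_eq_inv_mul (hM : ∀ x y : M, ∃ a b, a * x = b * y)
    (hj : Subgroup.closure (Set.range j) = ⊤) (g : G) : ∃ x y : M, g = (j x)⁻¹ * j y := by
  have hg : g ∈ Subgroup.closure (Set.range j) := hj ▸ Subgroup.mem_top g
  induction hg using Subgroup.closure_induction_left with
  | one => exact ⟨1, 1, by simp⟩
  | mul_left m hm g hg ih =>
    obtain ⟨m, rfl⟩ := hm
    obtain ⟨x, y, rfl⟩ := ih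
    obtain ⟨a, b, hab⟩ := hM m x
    have hab' : j a * j m = j b * j x := by rw [← map_mul, hab, map_mul]
    exact ⟨a, b * y, by
      rw [eq_inv_mul_iff_mul_eq, ← mul_assoc, hab', map_mul, mul_assoc, mul_inv_cancel_left]⟩
  | inv_mul_cancel m hm g hg ih =>
    obtain ⟨m, rfl⟩ := hm
    obtain ⟨x, y, rfl⟩ := ih
    exact ⟨x * m, y, by rw [map_mul, mul_inv_rev, mul_assoc]⟩

theorem IsGaussianMonoid.isGroupOfFractions (h : IsGaussianMonoid M)
    (hj : Subgroup.closure (Set.range j) = ⊤) (hinj : Function.Injective j) :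
    IsGroupOfFractions j where
  injective := hinj
  left_fraction := exists_eq_inv_mul h.exists_mul_left_eq hj
  right_fraction g := by
    obtain ⟨x, y, rfl⟩ := exists_eq_inv_mul h.exists_mul_left_eq hj g
    obtain ⟨a, b, hab⟩ := h.exists_mul_right_eq x y
    refine ⟨a, b, ?_⟩
    rw [inv_mul_eq_iff_eq_mul, ← mul_assoc, eq_mul_inv_iff_mul_eq, ← map_mul, ← map_mul, hab]

namespace IsGroupOfFractions

theorem bijective_of_comp_eq {G' : Type*} [Group G'] {ι : M →* G'} (hι : IsGroupOfFractions ι)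
    (hM : ∀ x y : M, ∃ a b, a * x = b * y) (hj : Subgroup.closure (Set.range j) = ⊤)
    {F : G →* G'} (hF : F.comp j = ι) : Function.Bijective F := by
  have hF' (x : M) : F (j x) = ι x := DFunLike.congr_fun hF x
  constructor
  · rw [injective_iff_map_eq_one]
    intro g hg
    obtain ⟨x, y, rfl⟩ := exists_eq_inv_mul hM hj g
    rw [map_mul, map_inv, hF', hF', inv_mul_eq_one] at hg
    rw [hι.injective hg, inv_mul_cancel]
  · intro g
    obtain ⟨x, y, rfl⟩ := hι.left_fraction g
    exact ⟨(j x)⁻¹ * j y, by rw [map_mul, map_inv, hF', hF']⟩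

theorem comp_mulEquiv {M' : Type*} [Monoid M'] (h : IsGroupOfFractions j) (φ : M' ≃* M) :
    IsGroupOfFractions (j.comp φ.toMonoidHom) where
  injective := h.injective.comp φ.injective
  left_fraction g := by
    obtain ⟨x, y, rfl⟩ := h.left_fraction g
    exact ⟨φ.symm x, φ.symm y, by simp⟩
  right_fraction g := by
    obtain ⟨x, y, rfl⟩ := h.right_fraction g
    exact ⟨φ.symm x, φ.symm y, by simp⟩

theorem mulEquiv_comp {G' : Type*} [Group G'] (h : IsGroupOfFractions j) (ψ : G ≃* G') :
    IsGroupOfFractions (ψ.toMonoidHom.comp j) where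
  injective := ψ.injective.comp h.injective
  left_fraction g := by
    obtain ⟨x, y, hxy⟩ := h.left_fraction (ψ.symm g)
    exact ⟨x, y, by simpa [MulEquiv.symm_apply_eq] using hxy⟩
  right_fraction g := by
    obtain ⟨x, y, hxy⟩ := h.right_fraction (ψ.symm g)
    exact ⟨x, y, by simpa [MulEquiv.symm_apply_eq] using hxy⟩

end IsGroupOfFractions

theorem IsGarsideGroup.of_mulEquiv {G G' : Type u} [Group G] [Group G'] (h : IsGarsideGroup G)
    (ψ : G ≃* G') : IsGarsideGroup G' := by
  obtain ⟨M, _, ι, hM, hι⟩ := h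
  exact ⟨M, _, _, hM, hι.mulEquiv_comp ψ⟩

namespace MonoidPresentation

variable (Q : MonoidPresentation)

theorem isGroupOfFractions_toEnvelope (h : IsGaussianMonoid Q.toMonoid) :
    IsGroupOfFractions Q.toEnvelope := by
  have := h.cancel
  obtain ⟨H, _, f, hf⟩ := exists_injective_hom_group h.exists_mul_left_eq
  obtain ⟨F, rfl⟩ := Q.exists_comp_toEnvelope_eq f
  exact h.isGroupOfFractions Q.closure_range_toEnvelope (.of_comp (f := F) hf)

theorem isGarsideGroup_groupPresentation (h : IsGarsideMonoid Q.toMonoid) :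
    IsGarsideGroup Q.groupPresentation.toGroup :=
  ⟨_, _, _, h, Q.isGroupOfFractions_toEnvelope h.gaussian⟩

theorem nonempty_mulEquiv_groupPresentation (h : IsGaussianMonoid Q.toMonoid) {G : Type*} [Group G]
    {ι : Q.toMonoid →* G} (hι : IsGroupOfFractions ι) :
    Nonempty (G ≃* Q.groupPresentation.toGroup) := by
  obtain ⟨F, hF⟩ := Q.exists_comp_toEnvelope_eq ι
  exact ⟨(MulEquiv.ofBijective F (hι.bijective_of_comp_eq h.exists_mul_left_eq
    Q.closure_range_toEnvelope hF)).symm⟩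

end MonoidPresentation

end Fractions

section GermPresentation

theorem IsComplementPresentation.of_mulEquiv {S : Type*} {rc : S → S → S} {e : S} {M N : Type*}
    [Monoid M] [Monoid N] {ι : S → M} (h : IsComplementPresentation rc e ι) (φ : M ≃* N) :
    IsComplementPresentation rc e fun s => φ (ι s) := by
  have hprod (u : List S) : (u.map fun s => φ (ι s)).prod = φ (u.map ι).prod := by
    simp only [map_list_prod, List.map_map, Function.comp_def]
  refine ⟨⟨?_, fun s t => ?_⟩, h.laws, fun x => ?_, fun u v huv => ?_⟩
  · rw [h.map_one, map_one]
  · rw [← map_mul, ← map_mul, h.map_rel]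
  · obtain ⟨u, hu⟩ := h.surj (φ.symm x)
    exact ⟨u, by rw [hprod, hu, φ.apply_symm_apply]⟩
  · rw [hprod, hprod] at huv
    exact h.wordEquiv u v (φ.injective huv)

/-- The relations `e = 1` and `s * f s t = t * f t s` of a complement `f` on the letters
`0, …, n - 1`. -/
def complementRels (n : ℕ) (f : ℕ → ℕ → ℕ) (e : ℕ) : List (List ℕ × List ℕ) :=
  ([e], []) :: (List.range n ×ˢ List.range n).map fun x => ([x.1, f x.1 x.2], [x.2, f x.2 x.1])

theorem mem_complementRels_iff {n : ℕ} {f : ℕ → ℕ → ℕ} {e : ℕ} {r : List ℕ × List ℕ} :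
    r ∈ complementRels n f e ↔
      r = ([e], []) ∨ ∃ s < n, ∃ t < n, r = ([s, f s t], [t, f t s]) := by
  simp only [complementRels, List.mem_cons, List.mem_map, SProd.sprod, Prod.exists,
    List.pair_mem_product, List.mem_range, and_assoc, exists_and_left, eq_comm (a := r)]

variable {Q : MonoidPresentation} {rc : Fin Q.1.1 → Fin Q.1.1 → Fin Q.1.1} {e : Fin Q.1.1}
  {f : ℕ → ℕ → ℕ}

theorem rels_iff_of_eq_complementRels (hf : ∀ s t : Fin Q.1.1, f s t = rc s t)
    (hQ : Q.1.2 = complementRels Q.1.1 f e) {u v : FreeMonoid (Fin Q.1.1)} :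
    Q.rels u v ↔ (u = .of e ∧ v = 1) ∨
      ∃ s t, u = .of s * .of (rc s t) ∧ v = .of t * .of (rc t s) := by
  have hval {w w' : FreeMonoid (Fin Q.1.1)} :
      w.toList.map Fin.val = w'.toList.map Fin.val ↔ w = w' :=
    (List.map_injective_iff.2 Fin.val_injective).eq_iff
  simp only [MonoidPresentation.rels, hQ, mem_complementRels_iff, Prod.mk.injEq, ← hval]
  refine or_congr Iff.rfl ⟨?_, fun ⟨s, t, h⟩ => ⟨s, s.2, t, t.2, ?_⟩⟩
  · rintro ⟨s, hs, t, ht, h⟩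
    exact ⟨⟨s, hs⟩, ⟨t, ht⟩, by simpa [← hf] using h⟩
  · simpa [← hf] using h

theorem ComplementLaws.isComplementPresentation_toMonoid (h : ComplementLaws rc e)
    (hf : ∀ s t : Fin Q.1.1, f s t = rc s t) (hQ : Q.1.2 = complementRels Q.1.1 f e) :
    IsComplementPresentation rc e (PresentedMonoid.of Q.rels) := by
  have hrel {u v : FreeMonoid (Fin Q.1.1)} := rels_iff_of_eq_complementRels (u := u) (v := v) hf hQ
  have hof : RespectsComplement rc e (PresentedMonoid.of Q.rels) :=
    ⟨PresentedMonoid.mk_eq_mk_of_rel (hrel.2 (.inl ⟨rfl, rfl⟩)),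
      fun s t => PresentedMonoid.mk_eq_mk_of_rel (hrel.2 (.inr ⟨s, t, rfl, rfl⟩))⟩
  have hκ := h.isComplementPresentation
  obtain ⟨F, hF⟩ := hκ.exists_lift hof
  let G : Q.toMonoid →* h.con.Quotient :=
    PresentedMonoid.lift (fun s => (FreeMonoid.of s : h.con.Quotient)) fun u v huv => by
      rcases hrel.1 huv with ⟨rfl, rfl⟩ | ⟨s, t, rfl, rfl⟩
      · simpa only [FreeMonoid.lift_eval_of, map_one] using hκ.map_one
      · simpa only [FreeMonoid.lift_eval_of, map_mul] using hκ.map_rel s t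
  have hG (s : Fin Q.1.1) : G (.of Q.rels s) = (FreeMonoid.of s : h.con.Quotient) := rfl
  have hGF : G.comp F = .id _ := hκ.hom_ext fun s => by simp [hF, hG]
  have hFG : F.comp G = .id _ := PresentedMonoid.ext _ fun s => by simp [hF, hG]
  simpa [hF] using hκ.of_mulEquiv (F.toMulEquiv G hGF hFG)

end GermPresentation

section GermCertificate

/-- The functions `f` and `g` restrict to the letters `0, …, n - 1`, and their restrictions satisfy
the laws of `IsHalfGerm`. -/
def IsHalfGermBelow (n : ℕ) (f g : ℕ → ℕ → ℕ) (e Δ : ℕ) : Prop :=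
  ∀ s < n, ∀ t < n, (f s t < n ∧ f s s = e ∧ f e s = s ∧ f s e = e ∧ f Δ s = e) ∧
    (∀ r < n, f (f s t) (f s r) = f (f t s) (f t r)) ∧
    ∃ r < n, (g r (f s t) = e ∧ g (f s t) r = s) ∧ (g r (f t s) = e ∧ g (f t s) r = t)

theorem isHalfGermBelow_iff {n : ℕ} {f g : ℕ → ℕ → ℕ} {rc lc : Fin n → Fin n → Fin n} {e Δ : Fin n}
    (hf : ∀ s t : Fin n, f s t = rc s t) (hg : ∀ s t : Fin n, g s t = lc s t) :
    IsHalfGermBelow n f g e Δ ↔ IsHalfGerm rc lc e Δ := by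
  constructor
  · intro h
    refine ⟨⟨fun s => ?_, fun s => ?_, fun s => ?_, fun r s t => ?_⟩, fun s => ?_, fun s t => ?_⟩
    · simpa only [hf, Fin.val_inj] using (h s s.2 s s.2).1.2.1
    · simpa only [hf, Fin.val_inj] using (h s s.2 s s.2).1.2.2.1
    · simpa only [hf, Fin.val_inj] using (h s s.2 s s.2).1.2.2.2.1
    · simpa only [hf, Fin.val_inj] using (h r r.2 s s.2).2.1 t t.2
    · simpa only [hf, Fin.val_inj] using (h s s.2 s s.2).1.2.2.2.2
    · obtain ⟨r, hr, hst⟩ := (h s s.2 t t.2).2.2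
      lift r to Fin n using hr
      exact ⟨r, by simpa only [IsQuotient, hf, hg, Fin.val_inj] using hst⟩
  · intro h s hs t ht
    lift s to Fin n using hs
    lift t to Fin n using ht
    obtain ⟨r, hst⟩ := h.exists_mul s t
    refine ⟨?_, fun r hr => ?_, r, r.2, ?_⟩
    · simp only [hf, Fin.is_lt, h.laws.self, h.laws.one_left, h.laws.one_right, h.top, and_self]
    · lift r to Fin n using hr
      simpa only [hf, Fin.val_inj] using h.laws.cube s t r
    · simpa only [IsQuotient, hf, hg, Fin.val_inj] using hst

/-- The entry in row `s` and column `t` of a table; missing entries are `0`. -/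
def tableEntry (T : List (List ℕ)) (s t : ℕ) : ℕ := (T.getD s []).getD t 0

theorem exists_tableEntry_eq {n : ℕ} (f : Fin n → Fin n → Fin n) :
    ∃ T, ∀ s t : Fin n, tableEntry T s t = f s t :=
  ⟨List.ofFn fun s => List.ofFn fun t => (f s t).val, fun s t => by simp [tableEntry]⟩

/-- `((T, U), e, Δ)` certifies that the letters of the presentation `Q` are the divisors of a
Garside element `Δ`, with right complement `T`, left complement `U` and unit `e`, and that the
relations of `Q` are those of the right complement. -/
def IsGermCertificate (Q : MonoidPresentation)
    (c : (List (List ℕ) × List (List ℕ)) × ℕ × ℕ) : Prop :=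
  (c.2.1 < Q.1.1 ∧ c.2.2 < Q.1.1) ∧
    (IsHalfGermBelow Q.1.1 (tableEntry c.1.1) (tableEntry c.1.2) c.2.1 c.2.2 ∧
      IsHalfGermBelow Q.1.1 (tableEntry c.1.2) (tableEntry c.1.1) c.2.1 c.2.2) ∧
    Q.1.2 = complementRels Q.1.1 (tableEntry c.1.1) c.2.1

theorem IsGermCertificate.isGarsideMonoid {Q : MonoidPresentation} {c} (h : IsGermCertificate Q c)
    {M : Type*} [Monoid M] (φ : Q.toMonoid ≃* M) : IsGarsideMonoid M := by
  obtain ⟨⟨he, hΔ⟩, ⟨hright, hleft⟩, hrels⟩ := h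
  have hrc (s t : Fin Q.1.1) : tableEntry c.1.1 s t < Q.1.1 := (hright s s.2 t t.2).1.1
  have hlc (s t : Fin Q.1.1) : tableEntry c.1.2 s t < Q.1.1 := (hleft s s.2 t t.2).1.1
  let rc (s t : Fin Q.1.1) : Fin Q.1.1 := ⟨_, hrc s t⟩
  let lc (s t : Fin Q.1.1) : Fin Q.1.1 := ⟨_, hlc s t⟩
  have hg : IsGerm rc lc ⟨_, he⟩ ⟨_, hΔ⟩ :=
    ⟨(isHalfGermBelow_iff (fun _ _ => rfl) fun _ _ => rfl).1 hright,
      (isHalfGermBelow_iff (fun _ _ => rfl) fun _ _ => rfl).1 hleft⟩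
  exact ((hg.right.laws.isComplementPresentation_toMonoid (fun _ _ => rfl) hrels).of_mulEquiv
    φ).isGarsideMonoid hg

theorem IsGarsideMonoid.exists_presentation {M : Type*} [Monoid M] (h : IsGarsideMonoid M) :
    ∃ Q c, IsGermCertificate Q c ∧ Nonempty (M ≃* Q.toMonoid) := by
  obtain ⟨n, ι, rc, lc, e, Δ, hg, hp⟩ := h.exists_isGerm
  obtain ⟨T, hT⟩ := exists_tableEntry_eq rc
  obtain ⟨U, hU⟩ := exists_tableEntry_eq lc
  have hQ : MonoidPresentationOk (n, complementRels n (tableEntry T) e) := by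
    intro r hr
    rcases mem_complementRels_iff.1 hr with rfl | ⟨s, hs, t, ht, rfl⟩
    · simp [WordBelow]
    · have hTs := hT ⟨s, hs⟩ ⟨t, ht⟩
      have hTt := hT ⟨t, ht⟩ ⟨s, hs⟩
      simp_all [WordBelow]
  refine ⟨⟨_, hQ⟩, ((T, U), e, Δ), ⟨⟨e.2, Δ.2⟩, ⟨(isHalfGermBelow_iff hT hU).2 hg.right,
    (isHalfGermBelow_iff hU hT).2 hg.left⟩, rfl⟩, hp.nonempty_mulEquiv
      (hg.right.laws.isComplementPresentation_toMonoid (Q := ⟨_, hQ⟩) hT rfl)⟩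

theorem primrecPred_isHalfGermBelow {A : Type*} [Primcodable A] {n e Δ : A → ℕ}
    {T U : A → List (List ℕ)} (hn : Primrec n) (he : Primrec e) (hΔ : Primrec Δ)
    (hT : Primrec T) (hU : Primrec U) :
    PrimrecPred fun x =>
      IsHalfGermBelow (n x) (tableEntry (T x)) (tableEntry (U x)) (e x) (Δ x) := by
  unfold IsHalfGermBelow tableEntry
  refine primrecPred_forall_lt (primrecPred_forall_lt (PrimrecPred.and ?_
    (PrimrecPred.and (primrecPred_forall_lt ?_ (by fun_prop))
      (primrecPred_exists_lt ?_ (by fun_prop)))) (by fun_prop)) hn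
  · refine (Primrec.nat_lt.comp ?_ ?_).and ((Primrec.eq.comp ?_ ?_).and ((Primrec.eq.comp ?_ ?_).and
      ((Primrec.eq.comp ?_ ?_).and (Primrec.eq.comp ?_ ?_)))) <;> fun_prop
  · refine Primrec.eq.comp ?_ ?_ <;> fun_prop
  · refine ((Primrec.eq.comp ?_ ?_).and (Primrec.eq.comp ?_ ?_)).and
      ((Primrec.eq.comp ?_ ?_).and (Primrec.eq.comp ?_ ?_)) <;> fun_prop

theorem primrec_monoidPresentation_val : Primrec fun Q : MonoidPresentation => Q.1 :=
  @Primrec.subtype_val _ _ _ _ primrecPred_monoidPresentationOk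

theorem primrecPred_isGermCertificate :
    PrimrecPred fun x : MonoidPresentation × (List (List ℕ) × List (List ℕ)) × ℕ × ℕ =>
      IsGermCertificate x.1 x.2 := by
  have hval := primrec_monoidPresentation_val
  have hrange := Primrec.list_range
  have hrels : Primrec fun x : MonoidPresentation × (List (List ℕ) × List (List ℕ)) × ℕ × ℕ =>
      complementRels x.1.1.1 (tableEntry x.2.1.1) x.2.2.1 := by
    unfold complementRels tableEntry
    simp only [SProd.sprod, List.product]
    fun_prop
  refine ((Primrec.nat_lt.comp ?_ ?_).and (Primrec.nat_lt.comp ?_ ?_)).and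
    (((primrecPred_isHalfGermBelow ?_ ?_ ?_ ?_ ?_).and
      (primrecPred_isHalfGermBelow ?_ ?_ ?_ ?_ ?_)).and (Primrec.eq.comp ?_ hrels)) <;> fun_prop

end GermCertificate

section Enumerability

theorem IsGermCertificate.isGarsideGroup {Q : MonoidPresentation} {c} (h : IsGermCertificate Q c) :
    IsGarsideGroup Q.groupPresentation.toGroup :=
  Q.isGarsideGroup_groupPresentation (h.isGarsideMonoid (.refl _))

theorem IsGarsideGroup.exists_presentation {G : Type*} [Group G] (h : IsGarsideGroup G) :
    ∃ Q c, IsGermCertificate Q c ∧ Nonempty (G ≃* Q.groupPresentation.toGroup) := by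
  obtain ⟨M, _, ι, hM, hι⟩ := h
  obtain ⟨Q, c, hc, ⟨φ⟩⟩ := hM.exists_presentation
  exact ⟨Q, c, hc, Q.nonempty_mulEquiv_groupPresentation (hc.isGarsideMonoid (.refl _)).gaussian
    (hι.comp_mulEquiv φ.symm)⟩

theorem exists_isGermCertificate : ∃ Q c, IsGermCertificate Q c :=
  ⟨⟨(1, complementRels 1 (tableEntry []) 0), by decide⟩, (([], []), 0, 0),
    by simp [IsGermCertificate, IsHalfGermBelow, tableEntry]⟩

theorem sigmaOne_exists_isGermCertificate :
    SigmaOne fun Q : MonoidPresentation => ∃ c, IsGermCertificate Q c :=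
  sigmaOne_exists_of_primrecRel primrecPred_isGermCertificate

theorem primrec_groupPresentation_val : Primrec fun P : GroupPresentation => P.1 :=
  @Primrec.subtype_val _ _ _ _ primrecPred_groupPresentationOk

theorem primrec_groupPresentation : Primrec MonoidPresentation.groupPresentation := by
  have hval := primrec_monoidPresentation_val
  refine @Primrec.subtype_mk _ _ _ _ _ _ primrecPred_groupPresentationOk _ _ ?_
  fun_prop

theorem sigmaOne_isGarsideMonoid :
    SigmaOne fun P : MonoidPresentation => IsGarsideMonoid P.toMonoid := by
  have hval := primrec_monoidPresentation_val
  have hrange := Primrec.list_range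
  have hequiv : SigmaOne fun x : MonoidPresentation × MonoidPresentation =>
      Nonempty (x.1.toMonoid ≃* x.2.toMonoid) :=
    sigmaOne_nonempty_mulEquiv (fun Q => Q.isFinitePresentation_eval) (by fun_prop) (by fun_prop)
      Primrec.fst Primrec.snd
  refine (sigmaOne_exists (p := fun (P : MonoidPresentation) Q =>
    (∃ c, IsGermCertificate Q c) ∧ Nonempty (P.toMonoid ≃* Q.toMonoid))
    ((sigmaOne_exists_isGermCertificate.comp Primrec.snd).and hequiv)).of_eq
    fun P => ⟨?_, fun h => ?_⟩
  · rintro ⟨Q, ⟨c, hc⟩, ⟨φ⟩⟩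
    exact hc.isGarsideMonoid φ.symm
  · obtain ⟨Q, c, hc, hφ⟩ := h.exists_presentation
    exact ⟨Q, ⟨c, hc⟩, hφ⟩

theorem primrec_letters : Primrec GroupPresentation.letters := by
  have hval := primrec_groupPresentation_val
  have hrange := Primrec.list_range
  unfold GroupPresentation.letters
  simp only [SProd.sprod, List.product]
  fun_prop

theorem primrec_monoidRels : Primrec GroupPresentation.monoidRels := by
  have hval := primrec_groupPresentation_val
  have hletters := primrec_letters
  have hnot : Primrec not := Primrec.not
  unfold GroupPresentation.monoidRels
  fun_prop

theorem sigmaOne_isGarsideGroup :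
    SigmaOne fun P : GroupPresentation => IsGarsideGroup P.toGroup := by
  have hequiv : SigmaOne fun x : GroupPresentation × MonoidPresentation =>
      Nonempty (x.1.toGroup ≃* x.2.groupPresentation.toGroup) :=
    sigmaOne_nonempty_mulEquiv (fun P => P.isFinitePresentation_eval) primrec_letters
      primrec_monoidRels Primrec.fst (primrec_groupPresentation.comp Primrec.snd)
  refine (sigmaOne_exists (p := fun (P : GroupPresentation) Q =>
    (∃ c, IsGermCertificate Q c) ∧ Nonempty (P.toGroup ≃* Q.groupPresentation.toGroup))
    ((sigmaOne_exists_isGermCertificate.comp Primrec.snd).and hequiv)).of_eq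
    fun P => ⟨?_, fun h => ?_⟩
  · rintro ⟨Q, ⟨c, hc⟩, ⟨φ⟩⟩
    exact hc.isGarsideGroup.of_mulEquiv φ.symm
  · obtain ⟨Q, c, hc, hφ⟩ := h.exists_presentation
    exact ⟨Q, ⟨c, hc⟩, hφ⟩

end Enumerability

end Garside

theorem mainTheorem3 :
    (REPred fun P : Garside.GroupPresentation => Garside.IsGarsideGroup P.toGroup) ∧
    (REPred fun P : Garside.MonoidPresentation => Garside.IsGarsideMonoid P.toMonoid) ∧
    (∃ f : ℕ → Garside.GroupPresentation, Computable f ∧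
      Set.range f = {P | Garside.IsGarsideGroup P.toGroup} ∧
      ∀ (G : Type u) [Group G], Garside.IsGarsideGroup G →
        ∃ n, Nonempty (G ≃* (f n).toGroup)) ∧
    (∃ f : ℕ → Garside.MonoidPresentation, Computable f ∧
      Set.range f = {P | Garside.IsGarsideMonoid P.toMonoid} ∧
      ∀ (M : Type u) [Monoid M], Garside.IsGarsideMonoid M →
        ∃ n, Nonempty (M ≃* (f n).toMonoid)) := by
  obtain ⟨Q₀, c₀, h₀⟩ := Garside.exists_isGermCertificate
  refine ⟨Garside.sigmaOne_isGarsideGroup.rePred, Garside.sigmaOne_isGarsideMonoid.rePred, ?_, ?_⟩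
  · obtain ⟨f, hf, hrange⟩ :=
      Garside.sigmaOne_isGarsideGroup.exists_computable_range ⟨_, h₀.isGarsideGroup⟩
    refine ⟨f, hf, hrange, fun G _ hG => ?_⟩
    obtain ⟨Q, c, hc, hφ⟩ := hG.exists_presentation
    obtain ⟨n, hn⟩ := hrange.ge hc.isGarsideGroup
    exact ⟨n, hn ▸ hφ⟩
  · obtain ⟨f, hf, hrange⟩ := Garside.sigmaOne_isGarsideMonoid.exists_computable_range
      ⟨_, h₀.isGarsideMonoid (.refl _)⟩
    refine ⟨f, hf, hrange, fun M _ hM => ?_⟩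
    obtain ⟨Q, c, hc, hφ⟩ := hM.exists_presentation
    obtain ⟨n, hn⟩ := hrange.ge (hc.isGarsideMonoid (.refl _))
    exact ⟨n, hn ▸ hφ⟩
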